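/- Let $(\mathcal A,\varphi)$ be a non-commutative probability space: $\mathcal A$ is a unital (associative) algebra over $\mathbb C$ and $\varphi:\mathcal A\to\mathbb C$ is a linear functional with $\varphi(1_{\mathcal A})=1$. For $m\ge 1$ let $\mathcal{NC}(m)$ be the set of non-crossing partitions of $[m]=\{1,\dots,m\}$, and write $|\pi|$ for the number of blocks of a partition $\pi$. The free cumulants $\kappa_m:\mathcal A^m\to\mathbb C$, $m\ge 1$, are defined recursively by $$\varphi(a_1\cdots a_m)=\sum_{\pi\in\mathcal{NC}(m)}\ \prod_{\substack{V\in\pi\\ V=\{v_1<\dots<v_k\}}}\kappa_k(a_{v_1},\dots,a_{v_k}),$$ and $\kappa_m(a):=\kappa_m(a,\dots,a)$. Let $n\ge 1$. For $\pi\in\mathcal{NC}(2n)$ let $\mathcal G_\pi$ be the multigraph whose vertices are the blocks of $\pi$ and which has, for each $k=1,\dots,n$, one edge joining the block containing $2k-1$ to the block containing $2k$ (loops and multiple edges are allowed). Put $$\mathcal X_{2n}=\{\pi\in\mathcal{NC}(2n):\ \mathcal G_\pi \text{ is connected and bipartite}\},$$ and let $\mathcal Y_{2n}$ be the set of those $\sigma\in\mathcal{NC}(2n)$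 for which the odd numbers $1,3,\dots,2n-1$ lie in pairwise different blocks and every block containing no odd number has an even number of elements. Let $a,b\in\mathcal A$ be freely independent, both with free Poisson distribution of parameter $\lambda\in\mathbb C$, i.e. $\kappa_m(a)=\kappa_m(b)=\lambda$ for all $m\ge 1$. Then, for every $n\ge 1$, $$\kappa_n(ab+ba)=2\sum_{\pi\in\mathcal X_{2n}}\lambda^{|\pi|}=2\sum_{\sigma\in\mathcal Y_{2n}}\lambda^{2n+1-|\sigma|}.$$ In particular, if $\lambda=1$, then $\kappa_n(ab+ba)=2\,|\mathcal Y_{2n}|$ for every $n\ge 1$. -/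

import Mathlib

namespace FreeProb

/-! ### Non-crossing partitions

Partitions of `[m] = {1, …, m}` are `Finpartition`s of `Finset.univ : Finset (Fin m)`; the element
`i : Fin m` stands for the number `i + 1`. In particular, the odd numbers `1, 3, …, 2n - 1` of
`[2n]` are the elements `i : Fin (2 * n)` with `Even i.val`. -/

/-- Partitions of `[m]`. The blocks of `π` are the members of `π.parts`. -/
abbrev SetPartition (m : ℕ) : Type := Finpartition (Finset.univ : Finset (Fin m))

/-- If `i < j < k < l` with `i, k` in the block `V` and `j, l` in the block `W`, then `V = W`. -/
def IsNonCrossing {m : ℕ} (π : SetPartition m) : Prop :=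
  ∀ i j k l : Fin m, i < j → j < k → k < l →
    ∀ V ∈ π.parts, ∀ W ∈ π.parts, i ∈ V → k ∈ V → j ∈ W → l ∈ W → V = W

open Classical in
/-- The set `NC(m)` of non-crossing partitions of `[m]`. -/
noncomputable def NC (m : ℕ) : Finset (SetPartition m) :=
  Finset.univ.filter IsNonCrossing

/-- A block of a partition of `[m]` other than the one-block partition has fewer than `m`
elements. -/
theorem card_block_lt {m : ℕ} {π : SetPartition m} (hπ : π.parts ≠ {Finset.univ})
    {V : Finset (Fin m)} (hV : V ∈ π.parts) : V.card < m := by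
  rcases lt_or_eq_of_le (Finset.card_le_univ V) with h | h
  · simpa using h
  · exfalso
    have hVu : V = Finset.univ := Finset.card_eq_iff_eq_univ V |>.mp h
    apply hπ
    refine Finset.eq_singleton_iff_unique_mem.mpr ⟨hVu ▸ hV, fun W hW => ?_⟩
    obtain ⟨x, hx⟩ := π.nonempty_of_mem_parts hW
    exact (π.eq_of_mem_parts hW hV hx (hVu ▸ Finset.mem_univ x)).trans hVu

/-! ### Free cumulants and freeness -/

section Cumulants

variable {A : Type*} [Ring A] [Algebra ℂ A]

open Classical in
/-- The free cumulants `κ_m(a_1, …, a_m)`, `m ≥ 1`, of `φ`, defined recursively by the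
moment-cumulant formula `φ(a_1 ⋯ a_m) = ∑_{π ∈ NC(m)} ∏_{V ∈ π} κ_{|V|}(a|_V)`, solved for the
term `κ_m(a_1, …, a_m)` that belongs to the one-block partition of `[m]`. Here `a|_V` lists
the `a_v`, `v ∈ V`, in increasing order of the indices. -/
noncomputable def freeCumulant (φ : A →ₗ[ℂ] ℂ) (m : ℕ) (a : Fin m → A) : ℂ :=
  φ (List.ofFn a).prod -
    ∑ π ∈ ((NC m).filter fun π => π.parts ≠ {Finset.univ}).attach,
      ∏ V ∈ π.1.parts.attach,
        freeCumulant φ V.1.card (fun i => a (V.1.orderEmbOfFin rfl i))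
termination_by m
decreasing_by exact card_block_lt (Finset.mem_filter.mp π.2).2 V.2

/-- `κ_m(a) = κ_m(a, …, a)`. -/
noncomputable def cumulant (φ : A →ₗ[ℂ] ℂ) (m : ℕ) (a : A) : ℂ :=
  freeCumulant φ m (fun _ => a)

/-- Freeness of a family of unital subalgebras: `φ(x_1 ⋯ x_m) = 0` whenever `m ≥ 1`, each `x_k`
is a centered element of the subalgebra with index `i_k`, and neighbouring indices differ. -/
def FreeSubalgebras (φ : A →ₗ[ℂ] ℂ) {ι : Type*} (S : ι → Subalgebra ℂ A) : Prop :=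
  ∀ (m : ℕ) (i : Fin (m + 1) → ι) (x : Fin (m + 1) → A),
    (∀ k : Fin m, i k.castSucc ≠ i k.succ) →
    (∀ k, x k ∈ S (i k)) → (∀ k, φ (x k) = 0) →
    φ (List.ofFn x).prod = 0

/-- `a` and `b` are free if the unital subalgebras generated by `a` and by `b` are free. -/
def Free (φ : A →ₗ[ℂ] ℂ) (a b : A) : Prop :=
  FreeSubalgebras φ ![Algebra.adjoin ℂ {a}, Algebra.adjoin ℂ {b}]

/-- `a` has the free Poisson distribution of parameter `r`: all its free cumulants equal `r`. -/
def IsFreePoisson (φ : A →ₗ[ℂ] ℂ) (r : ℂ) (a : A) : Prop :=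
  ∀ m : ℕ, 1 ≤ m → cumulant φ m a = r

end Cumulants

/-! ### The graph of a partition of `[2n]` -/

/-- The element `2k + 1` of `[2n]` (the first element of the `(k+1)`-st pair). -/
def pairFst {n : ℕ} (k : Fin n) : Fin (2 * n) := ⟨2 * k.val, by omega⟩

/-- The element `2k + 2` of `[2n]` (the second element of the `(k+1)`-st pair). -/
def pairSnd {n : ℕ} (k : Fin n) : Fin (2 * n) := ⟨2 * k.val + 1, by omega⟩

/-- The multigraph `G_π`: its vertices are the blocks of `π`, and it has one edge for each of
the `n` pairs `{1, 2}, {3, 4}, …, {2n - 1, 2n}`, joining the block of the first element of the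
pair to the block of the second. Loops and multiple edges are allowed. -/
def partitionGraph {n : ℕ} (π : SetPartition (2 * n)) : Graph (Finset (Fin (2 * n))) (Fin n) where
  vertexSet := {V | V ∈ π.parts}
  IsLink k V W := s(V, W) = s(π.part (pairFst k), π.part (pairSnd k))
  isLink_symm := fun k _ => ⟨fun V W h => by rw [Sym2.eq_swap]; exact h⟩
  eq_or_eq_of_isLink_of_isLink := by
    intro k x y v w h h'
    have h2 := h.trans h'.symm
    rw [Sym2.eq_iff] at h2
    rcases h2 with h2 | h2
    · exact Or.inl h2.1
    · exact Or.inr h2.1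
  left_mem_of_isLink := by
    intro k x y h
    rw [Sym2.eq_iff] at h
    rcases h with h | h
    · rw [h.1]; exact π.part_mem.mpr (Finset.mem_univ _)
    · rw [h.1]; exact π.part_mem.mpr (Finset.mem_univ _)

/-- A multigraph is connected if it has a vertex and any two vertices are joined by a path. -/
def GraphConnected {α β : Type*} (G : Graph α β) : Prop :=
  G.vertexSet.Nonempty ∧
    ∀ u ∈ G.vertexSet, ∀ v ∈ G.vertexSet, Relation.ReflTransGen G.Adj u v

/-- A multigraph is bipartite if its vertex set splits into two disjoint classes such that no
edge (in particular, no loop) joins two vertices of the same class. -/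
def GraphBipartite {α β : Type*} (G : Graph α β) : Prop :=
  ∃ P Q : Set α, P ∪ Q = G.vertexSet ∧ Disjoint P Q ∧
    ∀ u v, G.Adj u v → (u ∈ P ∧ v ∈ Q) ∨ (u ∈ Q ∧ v ∈ P)

/-! ### The sets `𝒳_{2n}` and `𝒴_{2n}` -/

open Classical in
/-- `𝒳_{2n}`: the non-crossing partitions `π` of `[2n]` with `G_π` connected and bipartite. -/
noncomputable def ncX (n : ℕ) : Finset (SetPartition (2 * n)) :=
  (NC (2 * n)).filter fun π =>
    GraphConnected (partitionGraph π) ∧ GraphBipartite (partitionGraph π)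

/-- `σ` separates the odd numbers `1, 3, …, 2n - 1`, and every block of `σ` that contains no odd
number has an even number of elements. -/
def SeparatesOdds {n : ℕ} (σ : SetPartition (2 * n)) : Prop :=
  (∀ V ∈ σ.parts, ∀ i ∈ V, ∀ j ∈ V, Even i.val → Even j.val → i = j) ∧
  (∀ V ∈ σ.parts, (∀ i ∈ V, ¬ Even i.val) → Even V.card)

open Classical in
/-- `𝒴_{2n}`: the non-crossing partitions `{B_1, B_3, …, B_{2n-1}, E_1, …, E_r}` of `[2n]`,
`r ≥ 0`, with `i ∈ B_i` for `i = 1, 3, …, 2n - 1` and every `|E_j|` even. -/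
noncomputable def ncY (n : ℕ) : Finset (SetPartition (2 * n)) :=
  (NC (2 * n)).filter SeparatesOdds

end FreeProb

/-! The proof has three independent ingredients.

Mixed moments: for a word in `a` and `b`, `φ` equals the sum of `r ^ |π|` over the non-crossing `π`
whose blocks are monochromatic (`moment_word`). Vanishing of mixed cumulants is not used. Instead
these sums define a functional on non-commutative polynomials which satisfies the freeness relation,
by an inclusion-exclusion over isolated runs (`sum_runs_eq_zero`). It has the same one-variable
moments as `φ`, and the freeness relation together with these moments determines a functional on all
words (`eq_zero_of_centered`).

Components: the words in the expansion of `(ab + ba)^n` are the two-colourings of `[2n]` that differ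
on the two elements of each pair. After exchanging sums, `π` is weighted by the number of proper
two-colourings of its graph, which is `2` to the number of components if the graph is bipartite and
`0` otherwise. The components form a non-crossing partition of `[n]` (`nonCrossing_comp`) and the
weight is multiplicative over them (`weight_bind`). The moments thus satisfy the moment-cumulant
formula with the sums over `𝒳` as cumulants, and `cumulant_unique` gives the first identity.

Kreweras complement: modulo two, a colouring is constant on the blocks of `π` iff its cyclic
differences sum to zero over every block of the complement (`constOnParts_iff_cyclicDiff`). A
colouring constant on pairs has difference `0` inside each pair, a proper one has difference `1`.
Solving these linear conditions turns connected and bipartite into the two conditions defining `𝒴`,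
and the block counts of `π` and its complement add up to `2n + 1`. -/

namespace FreeProb

/-! ### Non-crossing partitions of finite sets in a linear order -/

section Generic

variable {α γ κ : Type*} [LinearOrder α] [LinearOrder γ]

/-- Non-crossing partitions of a finite subset of a linear order. -/
def NonCrossing {s : Finset α} (π : Finpartition s) : Prop :=
  ∀ i j k l : α, i < j → j < k → k < l →
    ∀ V ∈ π.parts, ∀ W ∈ π.parts, i ∈ V → k ∈ V → j ∈ W → l ∈ W → V = W

/-- The function `c` is constant on every block of `π`. -/
def ConstOnParts {s : Finset α} (c : α → κ) (π : Finpartition s) : Prop :=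
  ∀ V ∈ π.parts, ∀ x ∈ V, ∀ y ∈ V, c x = c y

open Classical in
/-- The finite set of all non-crossing partitions of `s`. -/
noncomputable def ncParts (s : Finset α) : Finset (Finpartition s) :=
  Finset.univ.filter NonCrossing

theorem mem_ncParts {s : Finset α} {π : Finpartition s} : π ∈ ncParts s ↔ NonCrossing π := by
  simp [ncParts]

theorem NC_eq_ncParts (m : ℕ) : NC m = ncParts (Finset.univ : Finset (Fin m)) := by
  ext π
  simp [NC, ncParts, IsNonCrossing, NonCrossing]

theorem parts_eq_image_part {s : Finset α} (π : Finpartition s) : π.parts = s.image π.part := by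
  ext V
  simp only [Finset.mem_image]
  constructor
  · intro hV
    obtain ⟨x, hx⟩ := π.nonempty_of_mem_parts hV
    exact ⟨x, π.le hV hx, π.part_eq_of_mem hV hx⟩
  · rintro ⟨x, hx, rfl⟩
    exact π.part_mem.mpr hx

theorem finpartition_ext_part {s : Finset α} {π σ : Finpartition s}
    (h : ∀ x ∈ s, ∀ y ∈ s, π.part x = π.part y ↔ σ.part x = σ.part y) : π = σ := by
  apply Finpartition.ext
  rw [parts_eq_image_part π, parts_eq_image_part σ]
  apply Finset.image_congr
  intro x hx
  ext y
  have hx' : x ∈ s := hx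
  constructor
  · intro hy
    have hys := π.part_subset x hy
    rw [Finpartition.mem_part_iff_part_eq_part _ hys hx'] at hy ⊢
    exact (h y hys x hx').mp hy
  · intro hy
    have hys := σ.part_subset x hy
    rw [Finpartition.mem_part_iff_part_eq_part _ hys hx'] at hy ⊢
    exact (h y hys x hx').mpr hy

theorem ConstOnParts.eq_of_part_eq {s : Finset α} {c : α → κ} {π : Finpartition s}
    (h : ConstOnParts c π) {x y : α} (hx : x ∈ s) (hy : y ∈ s) (hxy : π.part x = π.part y) :
    c x = c y :=
  h _ (π.part_mem.mpr hy) x (hxy ▸ π.mem_part hx) y (π.mem_part hy)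

theorem constOnParts_of_part_eq {s : Finset α} {c : α → κ} {π : Finpartition s}
    (h : ∀ x ∈ s, ∀ y ∈ s, π.part x = π.part y → c x = c y) : ConstOnParts c π := by
  intro V hV x hx y hy
  exact h x (π.le hV hx) y (π.le hV hy)
    ((π.part_eq_of_mem hV hx).trans (π.part_eq_of_mem hV hy).symm)

theorem ConstOnParts.mono {s : Finset α} {c : α → κ} {π ρ : Finpartition s} (h : π ≤ ρ)
    (hc : ConstOnParts c ρ) : ConstOnParts c π := by
  intro V hV x hx y hy
  obtain ⟨W, hW, hVW⟩ := h hV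
  exact hc W hW x (hVW hx) y (hVW hy)

theorem le_iff_constOnParts_part {s : Finset α} {π ρ : Finpartition s} :
    π ≤ ρ ↔ ConstOnParts ρ.part π := by
  constructor
  · intro h V hV x hx y hy
    obtain ⟨W, hW, hVW⟩ := h hV
    rw [ρ.part_eq_of_mem hW (hVW hx), ρ.part_eq_of_mem hW (hVW hy)]
  · intro h V hV
    obtain ⟨x, hx⟩ := π.nonempty_of_mem_parts hV
    refine ⟨ρ.part x, ρ.part_mem.mpr (π.le hV hx), fun y hy => ?_⟩
    rw [h V hV x hx y hy]
    exact ρ.mem_part (π.le hV hy)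

/-! ### Factorization of the interval below a non-crossing partition -/

/-- A crossing between pieces of two different blocks of `ρ` would be a crossing of `ρ`, so only
crossings inside a single block have to be excluded. -/
theorem NonCrossing.bind {s : Finset α} {ρ : Finpartition s} (hρ : NonCrossing ρ)
    {Q : ∀ V ∈ ρ.parts, Finpartition V} (hQ : ∀ V hV, NonCrossing (Q V hV)) :
    NonCrossing (ρ.bind Q) := by
  intro i j k l hij hjk hkl V hV W hW hi hk hj hl
  rw [Finpartition.mem_bind] at hV hW
  obtain ⟨A, hA, hV⟩ := hV
  obtain ⟨B, hB, hW⟩ := hW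
  obtain rfl := hρ i j k l hij hjk hkl A hA B hB ((Q A hA).le hV hi) ((Q A hA).le hV hk)
    ((Q B hB).le hW hj) ((Q B hB).le hW hl)
  exact hQ A hA i j k l hij hjk hkl V hV W hW hi hk hj hl

theorem bind_le {s : Finset α} (ρ : Finpartition s) (Q : ∀ V ∈ ρ.parts, Finpartition V) :
    ρ.bind Q ≤ ρ := by
  intro V hV
  rw [Finpartition.mem_bind] at hV
  obtain ⟨A, hA, hV⟩ := hV
  exact ⟨A, hA, (Q A hA).le hV⟩

theorem mem_restrict_iff {s t : Finset α} (π : Finpartition s) (h : t ≤ s) {V : Finset α} :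
    V ∈ (π.restrict h).parts ↔ V.Nonempty ∧ ∃ W ∈ π.parts, W ∩ t = V := by
  simp [Finpartition.restrict, Finset.nonempty_iff_ne_empty]

theorem NonCrossing.restrict {s t : Finset α} {π : Finpartition s} (hπ : NonCrossing π)
    (h : t ≤ s) : NonCrossing (π.restrict h) := by
  intro i j k l hij hjk hkl V hV W hW hi hk hj hl
  rw [mem_restrict_iff] at hV hW
  obtain ⟨-, V', hV', rfl⟩ := hV
  obtain ⟨-, W', hW', rfl⟩ := hW
  simp only [Finset.mem_inter] at hi hj hk hl
  rw [hπ i j k l hij hjk hkl V' hV' W' hW' hi.1 hk.1 hj.1 hl.1]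

/-- Together with `restrict_bind` this identifies the partitions below `ρ` with families of
partitions of the blocks of `ρ`. -/
theorem bind_restrict {s : Finset α} {π ρ : Finpartition s} (h : π ≤ ρ) :
    ρ.bind (fun _ hV => π.restrict (ρ.le hV)) = π := by
  apply Finpartition.ext
  ext V
  simp only [Finpartition.mem_bind, mem_restrict_iff]
  constructor
  · rintro ⟨A, hA, hne, W, hW, rfl⟩
    obtain ⟨B, hB, hWB⟩ := h hW
    obtain ⟨x, hx⟩ := hne
    rw [Finset.mem_inter] at hx
    obtain rfl := ρ.eq_of_mem_parts hA hB hx.2 (hWB hx.1)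
    rwa [Finset.inter_eq_left.mpr hWB]
  · intro hV
    obtain ⟨B, hB, hVB⟩ := h hV
    exact ⟨B, hB, π.nonempty_of_mem_parts hV, V, hV, Finset.inter_eq_left.mpr hVB⟩

theorem restrict_bind {s : Finset α} (ρ : Finpartition s) (Q : ∀ V ∈ ρ.parts, Finpartition V)
    {V : Finset α} (hV : V ∈ ρ.parts) : (ρ.bind Q).restrict (ρ.le hV) = Q V hV := by
  apply Finpartition.ext
  ext U
  simp only [mem_restrict_iff, Finpartition.mem_bind]
  constructor
  · rintro ⟨hne, W, ⟨A, hA, hW⟩, rfl⟩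
    obtain ⟨x, hx⟩ := hne
    rw [Finset.mem_inter] at hx
    obtain rfl := ρ.eq_of_mem_parts hA hV ((Q A hA).le hW hx.1) hx.2
    rwa [Finset.inter_eq_left.mpr ((Q A hA).le hW)]
  · intro hU
    exact ⟨(Q V hV).nonempty_of_mem_parts hU, U, ⟨V, hV, hU⟩,
      Finset.inter_eq_left.mpr ((Q V hV).le hU)⟩

open Classical in
/-- Sums over the non-crossing partitions below a non-crossing partition `ρ` factorize over the
blocks of `ρ`. -/
theorem sum_ncParts_le_eq_prod {R : Type*} [CommSemiring R] {s : Finset α} {ρ : Finpartition s}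
    (hρ : NonCrossing ρ) (F : Finpartition s → R) (f : ∀ V : Finset α, Finpartition V → R)
    (hF : ∀ Q : ∀ V ∈ ρ.parts, Finpartition V,
      F (ρ.bind Q) = ∏ V ∈ ρ.parts.attach, f V.1 (Q V.1 V.2)) :
    ∑ π ∈ (ncParts s).filter (· ≤ ρ), F π = ∏ V ∈ ρ.parts, ∑ π ∈ ncParts V, f V π := by
  rw [Finset.prod_sum]
  symm
  refine Finset.sum_bij' (fun Q _ => ρ.bind Q) (fun π _ V hV => π.restrict (ρ.le hV))
    ?_ ?_ ?_ ?_ ?_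
  · intro Q hQ
    rw [Finset.mem_pi] at hQ
    rw [Finset.mem_filter, mem_ncParts]
    exact ⟨hρ.bind fun V hV => mem_ncParts.mp (hQ V hV), bind_le ρ Q⟩
  · intro π hπ
    rw [Finset.mem_filter, mem_ncParts] at hπ
    rw [Finset.mem_pi]
    exact fun V hV => mem_ncParts.mpr (hπ.1.restrict _)
  · intro Q _
    funext V hV
    exact restrict_bind ρ Q hV
  · intro π hπ
    rw [Finset.mem_filter] at hπ
    exact bind_restrict hπ.2
  · intro Q _
    exact (hF Q).symm

theorem constOnParts_bind {s : Finset α} {ρ : Finpartition s}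
    {Q : ∀ V ∈ ρ.parts, Finpartition V} {c : α → κ} :
    ConstOnParts c (ρ.bind Q) ↔ ∀ V hV, ConstOnParts c (Q V hV) := by
  constructor
  · intro h V hV U hU
    exact h U (Finpartition.mem_bind.mpr ⟨V, hV, hU⟩)
  · intro h U hU
    obtain ⟨V, hV, hU⟩ := Finpartition.mem_bind.mp hU
    exact h V hV U hU

theorem sum_ncParts_empty {R : Type*} [AddCommMonoid R] (F : ℕ → R) {s : Finset α} (hs : s = ∅) :
    ∑ π ∈ ncParts s, F π.parts.card = F 0 := by
  subst hs
  have h : ncParts (∅ : Finset α) = {⊥} := by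
    ext π
    rw [mem_ncParts, Finset.mem_singleton]
    have hπ : π.parts = ∅ := π.parts_eq_empty_iff.mpr rfl
    refine ⟨fun _ => Finpartition.ext ?_, fun _ i j k l _ _ _ V hV => ?_⟩
    · rw [hπ]
      rfl
    · simp [hπ] at hV
  rw [h, Finset.sum_singleton]
  rfl

/-! ### Transport along order embeddings -/

/-- The image of a partition under an embedding. -/
def mapEmb (e : α ↪o γ) {s : Finset α} (π : Finpartition s) :
    Finpartition (s.map e.toEmbedding) where
  parts := π.parts.map (Finset.mapEmbedding e.toEmbedding).toEmbedding
  supIndep := by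
    rw [Finset.supIndep_iff_pairwiseDisjoint]
    intro V hV W hW hVW
    simp only [Finset.coe_map, Set.mem_image, Finset.mem_coe] at hV hW
    obtain ⟨V, hV, rfl⟩ := hV
    obtain ⟨W, hW, rfl⟩ := hW
    have hne : V ≠ W := by rintro rfl; exact hVW rfl
    have := π.disjoint hV hW hne
    simpa [Function.onFun] using this
  sup_parts := by
    ext x
    simp only [Finset.mem_sup, Finset.mem_map, id]
    constructor
    · rintro ⟨_, ⟨V, hV, rfl⟩, hx⟩
      simp only [RelEmbedding.coe_toEmbedding, Finset.mapEmbedding_apply, Finset.mem_map] at hx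
      obtain ⟨a, ha, rfl⟩ := hx
      exact ⟨a, π.le hV ha, rfl⟩
    · rintro ⟨a, ha, rfl⟩
      refine ⟨_, ⟨π.part a, π.part_mem.mpr ha, rfl⟩, ?_⟩
      simpa using π.mem_part ha
  bot_notMem := by
    simp only [Finset.bot_eq_empty, Finset.mem_map, not_exists, not_and]
    intro V hV h
    simp only [RelEmbedding.coe_toEmbedding, Finset.mapEmbedding_apply, Finset.map_eq_empty] at h
    exact π.ne_empty hV h

theorem mem_mapEmb {e : α ↪o γ} {s : Finset α} {π : Finpartition s} {V : Finset γ} :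
    V ∈ (mapEmb e π).parts ↔ ∃ W ∈ π.parts, W.map e.toEmbedding = V := by
  simp [mapEmb]

theorem card_mapEmb (e : α ↪o γ) {s : Finset α} (π : Finpartition s) :
    (mapEmb e π).parts.card = π.parts.card := by
  simp [mapEmb]

theorem mapEmb_injective (e : α ↪o γ) (s : Finset α) :
    Function.Injective (mapEmb e : Finpartition s → _) := by
  intro π σ h
  apply Finpartition.ext
  exact Finset.map_injective _ (congrArg Finpartition.parts h)

theorem nonCrossing_mapEmb {e : α ↪o γ} {s : Finset α} {π : Finpartition s} :
    NonCrossing (mapEmb e π) ↔ NonCrossing π := by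
  constructor
  · intro h i j k l hij hjk hkl V hV W hW hi hk hj hl
    have := h (e i) (e j) (e k) (e l) (by simpa) (by simpa) (by simpa)
      _ (mem_mapEmb.mpr ⟨V, hV, rfl⟩) _ (mem_mapEmb.mpr ⟨W, hW, rfl⟩)
      (by simpa) (by simpa) (by simpa) (by simpa)
    exact Finset.map_injective _ this
  · intro h i j k l hij hjk hkl V hV W hW hi hk hj hl
    obtain ⟨V, hV', rfl⟩ := mem_mapEmb.mp hV
    obtain ⟨W, hW', rfl⟩ := mem_mapEmb.mp hW
    simp only [Finset.mem_map, RelEmbedding.coe_toEmbedding] at hi hj hk hl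
    obtain ⟨i, hi, rfl⟩ := hi
    obtain ⟨j, hj, rfl⟩ := hj
    obtain ⟨k, hk, rfl⟩ := hk
    obtain ⟨l, hl, rfl⟩ := hl
    rw [h i j k l (by simpa using hij) (by simpa using hjk) (by simpa using hkl) V hV' W hW'
      hi hk hj hl]

theorem constOnParts_mapEmb {e : α ↪o γ} {s : Finset α} {π : Finpartition s} {c : γ → κ} :
    ConstOnParts c (mapEmb e π) ↔ ConstOnParts (c ∘ e) π := by
  constructor
  · intro h V hV x hx y hy
    exact h _ (mem_mapEmb.mpr ⟨V, hV, rfl⟩) (e x) (by simpa) (e y) (by simpa)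
  · intro h V hV x hx y hy
    obtain ⟨V, hV', rfl⟩ := mem_mapEmb.mp hV
    simp only [Finset.mem_map, RelEmbedding.coe_toEmbedding] at hx hy
    obtain ⟨x, hx, rfl⟩ := hx
    obtain ⟨y, hy, rfl⟩ := hy
    exact h V hV' x hx y hy

theorem mapEmb_surjective (e : α ↪o γ) (s : Finset α) :
    Function.Surjective (mapEmb e : Finpartition s → _) := by
  classical
  intro π
  -- The preimage is the pullback of `π`: two points are related when their images share a block.
  let S : Setoid α := Setoid.comap (fun x => π.part (e x)) ⊥
  refine ⟨Finpartition.ofSetSetoid S s, ?_⟩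
  set σ := Finpartition.ofSetSetoid S s with hσ
  have hpart : ∀ x ∈ s, (σ.part x).map e.toEmbedding = π.part (e x) := by
    intro x hx
    have hxe : e x ∈ s.map e.toEmbedding := by simpa
    ext y
    simp only [Finset.mem_map, hσ, Finpartition.mem_part_ofSetSetoid_iff_rel]
    constructor
    · rintro ⟨b, ⟨-, hb, hxb⟩, rfl⟩
      have hxb : π.part (e x) = π.part (e b) := hxb
      rw [hxb]
      exact π.mem_part (by simpa)
    · intro hy
      obtain ⟨b, hb, rfl⟩ := Finset.mem_map.mp (π.part_subset _ hy)
      refine ⟨b, ⟨hx, hb, ?_⟩, rfl⟩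
      have := (Finpartition.mem_part_iff_part_eq_part π (by simpa using hb) hxe).mp hy
      exact this.symm
  apply Finpartition.ext
  ext V
  rw [mem_mapEmb]
  constructor
  · rintro ⟨W, hW, rfl⟩
    obtain ⟨x, hx⟩ := σ.nonempty_of_mem_parts hW
    have hxs := σ.le hW hx
    rw [← σ.part_eq_of_mem hW hx, hpart x hxs]
    exact π.part_mem.mpr (by simpa)
  · intro hV
    obtain ⟨y, hy⟩ := π.nonempty_of_mem_parts hV
    obtain ⟨x, hx, rfl⟩ := Finset.mem_map.mp (π.le hV hy)
    exact ⟨σ.part x, σ.part_mem.mpr hx, (hpart x hx).trans (π.part_eq_of_mem hV hy)⟩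

theorem sum_ncParts_map {R : Type*} [AddCommMonoid R] (e : α ↪o γ) (s : Finset α)
    (F : Finpartition (s.map e.toEmbedding) → R) :
    ∑ π ∈ ncParts (s.map e.toEmbedding), F π = ∑ π ∈ ncParts s, F (mapEmb e π) := by
  symm
  refine Finset.sum_bij (fun π _ => mapEmb e π) ?_ ?_ ?_ ?_
  · intro π hπ
    rw [mem_ncParts] at hπ ⊢
    exact nonCrossing_mapEmb.mpr hπ
  · intro π _ σ _ h
    exact mapEmb_injective e s h
  · intro π hπ
    obtain ⟨σ, rfl⟩ := mapEmb_surjective e s π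
    rw [mem_ncParts] at hπ
    exact ⟨σ, mem_ncParts.mpr (nonCrossing_mapEmb.mp hπ), rfl⟩
  · intro π _
    rfl

/-- The version of `sum_ncParts_map` for a set that is only propositionally an image. -/
theorem sum_ncParts_eq_of_map_eq {R : Type*} [AddCommMonoid R] (e : α ↪o γ) {s : Finset α}
    {t : Finset γ} (h : s.map e.toEmbedding = t) (F : Finpartition t → R) (G : Finpartition s → R)
    (hFG : ∀ π : Finpartition s, F ((mapEmb e π).copy h) = G π) :
    ∑ π ∈ ncParts t, F π = ∑ π ∈ ncParts s, G π := by
  subst h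
  rw [sum_ncParts_map]
  exact Finset.sum_congr rfl fun π _ => hFG π

end Generic

/-! ### The moment-cumulant formula for one variable -/

section OneVariable

variable {A : Type*} [Ring A] [Algebra ℂ A]

open Classical in
theorem moment_eq_cumulant_add (φ : A →ₗ[ℂ] ℂ) (m : ℕ) (x : A) :
    φ (x ^ m) = cumulant φ m x +
      ∑ π ∈ (NC m).filter fun π => π.parts ≠ {Finset.univ},
        ∏ V ∈ π.parts, cumulant φ V.card x := by
  have h : cumulant φ m x = φ (x ^ m) -
      ∑ π ∈ (NC m).filter fun π => π.parts ≠ {Finset.univ},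
        ∏ V ∈ π.parts, cumulant φ V.card x := by
    rw [cumulant, freeCumulant, ← Finset.sum_attach ((NC m).filter _)]
    congr 1
    · simp
    · refine Finset.sum_congr rfl fun π _ => ?_
      exact Finset.prod_attach _ (fun V : Finset (Fin m) => cumulant φ V.card x)
  rw [h]
  ring

-- The one-block partition, present only for `m ≥ 1`, is split off, to match the shape of the
-- cumulant recursion.
open Classical in
theorem sum_NC_eq_add {m : ℕ} (hm : 1 ≤ m) (f : ℕ → ℂ) :
    ∑ π ∈ NC m, ∏ V ∈ π.parts, f V.card = f m +
      ∑ π ∈ (NC m).filter fun π => π.parts ≠ {Finset.univ}, ∏ V ∈ π.parts, f V.card := by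
  have : Nonempty (Fin m) := ⟨⟨0, hm⟩⟩
  have hne : (Finset.univ : Finset (Fin m)) ≠ ⊥ := Finset.univ_nonempty.ne_empty
  have h1 : (NC m).filter (fun π => π.parts = {Finset.univ}) = {Finpartition.indiscrete hne} := by
    ext π
    simp only [Finset.mem_filter, Finset.mem_singleton]
    constructor
    · rintro ⟨-, h⟩
      exact Finpartition.ext h
    · rintro rfl
      refine ⟨?_, rfl⟩
      rw [NC_eq_ncParts, mem_ncParts]
      intro i j k l _ _ _ V hV W hW _ _ _ _
      simp only [Finpartition.indiscrete_parts, Finset.mem_singleton] at hV hW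
      rw [hV, hW]
  rw [← Finset.sum_filter_add_sum_filter_not (NC m) (fun π => π.parts = {Finset.univ}), h1]
  simp

theorem moment_eq_sum (φ : A →ₗ[ℂ] ℂ) {m : ℕ} (hm : 1 ≤ m) (x : A) :
    φ (x ^ m) = ∑ π ∈ NC m, ∏ V ∈ π.parts, cumulant φ V.card x := by
  rw [moment_eq_cumulant_add, sum_NC_eq_add hm (fun k => cumulant φ k x)]

theorem one_le_card_part {m : ℕ} {π : SetPartition m} {V : Finset (Fin m)} (hV : V ∈ π.parts) :
    1 ≤ V.card :=
  Finset.card_pos.mpr (π.nonempty_of_mem_parts hV)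

/-- The moment-cumulant formula determines the cumulants. -/
theorem cumulant_unique (φ : A →ₗ[ℂ] ℂ) (x : A) (g : ℕ → ℂ)
    (h : ∀ m, 1 ≤ m → φ (x ^ m) = ∑ π ∈ NC m, ∏ V ∈ π.parts, g V.card) {m : ℕ} (hm : 1 ≤ m) :
    cumulant φ m x = g m := by
  induction m using Nat.strong_induction_on with
  | _ m ih =>
    have h1 := h m hm
    rw [moment_eq_cumulant_add, sum_NC_eq_add hm g] at h1
    refine add_right_cancel (b := _) (h1.trans ?_)
    congr 1
    -- The remaining partitions have only blocks smaller than `m`, where the induction hypothesis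
    -- applies.
    refine Finset.sum_congr rfl fun π hπ => Finset.prod_congr rfl fun V hV => ?_
    exact (ih V.card (card_block_lt (Finset.mem_filter.mp hπ).2 hV) (one_le_card_part hV)).symm

theorem moment_eq_sum_of_isFreePoisson {φ : A →ₗ[ℂ] ℂ} (hφ : φ 1 = 1) {r : ℂ} {x : A}
    (hx : IsFreePoisson φ r x) (m : ℕ) :
    φ (x ^ m) = ∑ π ∈ ncParts (Finset.univ : Finset (Fin m)), r ^ π.parts.card := by
  rcases Nat.eq_zero_or_pos m with rfl | hm
  · rw [sum_ncParts_empty (fun k => r ^ k) (by simp), pow_zero, pow_zero, hφ]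
  · rw [← NC_eq_ncParts, moment_eq_sum φ hm]
    refine Finset.sum_congr rfl fun π _ => ?_
    rw [Finset.prod_congr rfl fun V hV => hx V.card (one_le_card_part hV), Finset.prod_const]

end OneVariable

/-! ### Generating sums of non-crossing partitions with constant colours on blocks -/

section ColoredSums

variable {α γ κ ι : Type*} [LinearOrder α] [LinearOrder γ]

open Classical in
/-- The sum of `r ^ |π|` over all non-crossing partitions `π` of `s` on whose blocks `w` is
constant. -/
noncomputable def coloredSum (r : ℂ) (s : Finset α) (w : α → κ) : ℂ :=
  ∑ π ∈ ncParts s, if ConstOnParts w π then r ^ π.parts.card else 0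

/-- The generating sum of a word. -/
noncomputable def wordSum (r : ℂ) (L : List κ) : ℂ :=
  coloredSum r (Finset.univ : Finset (Fin L.length)) L.get

theorem coloredSum_empty (r : ℂ) (w : α → κ) : coloredSum r ∅ w = 1 := by
  classical
  have h : ∀ π : Finpartition (∅ : Finset α), ConstOnParts w π := by
    intro π V hV
    rw [π.parts_eq_empty_iff.mpr rfl] at hV
    simp at hV
  rw [coloredSum, Finset.sum_congr rfl fun π _ => if_pos (h π),
    sum_ncParts_empty (fun k => r ^ k) rfl, pow_zero]

theorem coloredSum_map (r : ℂ) (e : α ↪o γ) {s : Finset α} {t : Finset γ}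
    (h : s.map e.toEmbedding = t) (w : γ → κ) : coloredSum r t w = coloredSum r s (w ∘ e) := by
  classical
  subst h
  rw [coloredSum, sum_ncParts_map, coloredSum]
  simp only [constOnParts_mapEmb, card_mapEmb]

/-- Lets words be handled as colourings of any finite ordered set, so that subwords become subsets.
-/
theorem wordSum_sort (r : ℂ) (s : Finset α) (w : α → κ) :
    wordSum r (s.sort.map w) = coloredSum r s w := by
  have hl : s.card = (s.sort.map w).length := by simp
  rw [wordSum, coloredSum_map r (s.orderEmbOfFin hl) (Finset.map_orderEmbOfFin_univ s hl)]
  congr 1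
  funext i
  simp [Finset.orderEmbOfFin_apply]

theorem wordSum_ofFn (r : ℂ) {m : ℕ} (w : Fin m → κ) :
    wordSum r (List.ofFn w) = coloredSum r Finset.univ w := by
  rw [← wordSum_sort, Fin.sort_univ, List.ofFn_eq_map]

theorem wordSum_replicate (r : ℂ) (m : ℕ) (t : κ) :
    wordSum r (List.replicate m t) =
      ∑ π ∈ ncParts (Finset.univ : Finset (Fin m)), r ^ π.parts.card := by
  rw [← List.ofFn_const, wordSum_ofFn, coloredSum]
  exact Finset.sum_congr rfl fun π _ => if_pos fun _ _ _ _ _ _ => rfl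

open Classical in
/-- The partition of `s` into the fibres of `q`. -/
noncomputable def fiberPartition (s : Finset α) (q : α → ι) : Finpartition s :=
  Finpartition.ofSetSetoid (Setoid.ker q) s

theorem mem_fiberPartition_part {s : Finset α} {q : α → ι} {x y : α} :
    y ∈ (fiberPartition s q).part x ↔ x ∈ s ∧ y ∈ s ∧ q x = q y := by
  classical
  exact Finpartition.mem_part_ofSetSetoid_iff_rel s

open Classical in
theorem mem_fiberPartition {s : Finset α} {q : α → ι} {V : Finset α} :
    V ∈ (fiberPartition s q).parts ↔ ∃ x ∈ s, s.filter (fun y => q y = q x) = V := by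
  rw [fiberPartition, Finpartition.ofSetSetoid_parts, Finset.mem_image]
  simp [eq_comm]

theorem constOnParts_fiberPartition (s : Finset α) (q : α → ι) :
    ConstOnParts q (fiberPartition s q) := by
  classical
  intro V hV x hx y hy
  obtain ⟨z, -, rfl⟩ := mem_fiberPartition.mp hV
  rw [Finset.mem_filter] at hx hy
  exact hx.2.trans hy.2.symm

theorem le_fiberPartition_iff {s : Finset α} {q : α → ι} {π : Finpartition s} :
    π ≤ fiberPartition s q ↔ ConstOnParts q π := by
  constructor
  · intro h
    exact (constOnParts_fiberPartition s q).mono h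
  · intro h
    rw [le_iff_constOnParts_part]
    intro V hV x hx y hy
    have hxs := π.le hV hx
    have hys := π.le hV hy
    rw [← Finpartition.mem_part_iff_part_eq_part _ hxs hys, mem_fiberPartition_part]
    exact ⟨hys, hxs, h V hV y hy x hx⟩

theorem nonCrossing_fiberPartition {s : Finset α} {q : α → ι}
    (h : ∀ i ∈ s, ∀ j ∈ s, ∀ k ∈ s, ∀ l ∈ s, i < j → j < k → k < l → q i = q k → q j = q l →
      q i = q j) : NonCrossing (fiberPartition s q) := by
  classical
  intro i j k l hij hjk hkl V hV W hW hi hk hj hl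
  have hik := constOnParts_fiberPartition s q V hV i hi k hk
  have hjl := constOnParts_fiberPartition s q W hW j hj l hl
  have hP := fun {x} {U} (hU : U ∈ (fiberPartition s q).parts) (hx : x ∈ U) =>
    (fiberPartition s q).le hU hx
  have := h i (hP hV hi) j (hP hW hj) k (hP hV hk) l (hP hW hl) hij hjk hkl hik hjl
  refine (fiberPartition s q).eq_of_mem_parts hV hW hi ?_
  obtain ⟨z, hz, rfl⟩ := mem_fiberPartition.mp hW
  rw [Finset.mem_filter] at hj ⊢
  exact ⟨hP hV hi, this.trans hj.2⟩

-- Labels with empty fibre give no block; `hg` makes their factors harmless.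
open Classical in
theorem prod_fiberPartition {R : Type*} [CommMonoid R] [Fintype ι] (s : Finset α) (q : α → ι)
    (g : Finset α → R) (hg : g ∅ = 1) :
    ∏ V ∈ (fiberPartition s q).parts, g V = ∏ l : ι, g (s.filter fun x => q x = l) := by
  have h : (fiberPartition s q).parts =
      (Finset.univ.filter fun l : ι => (s.filter fun x => q x = l).Nonempty).image
        fun l => s.filter fun x => q x = l := by
    ext V
    rw [mem_fiberPartition, Finset.mem_image]
    constructor
    · rintro ⟨x, hx, rfl⟩
      refine ⟨q x, ?_, rfl⟩
      rw [Finset.mem_filter]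
      exact ⟨Finset.mem_univ _, x, Finset.mem_filter.mpr ⟨hx, rfl⟩⟩
    · rintro ⟨l, hl, rfl⟩
      obtain ⟨x, hx⟩ := (Finset.mem_filter.mp hl).2
      rw [Finset.mem_filter] at hx
      exact ⟨x, hx.1, by rw [hx.2]⟩
  rw [h, Finset.prod_image, Finset.prod_filter_of_ne]
  · intro l _ hl
    rw [Finset.nonempty_iff_ne_empty]
    intro h0
    exact hl (by rw [h0, hg])
  · intro l hl l' _ hll
    obtain ⟨x, hx⟩ := (Finset.mem_filter.mp hl).2
    have hx' : x ∈ s.filter fun x => q x = l' := by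
      have := hx
      simp only at hll
      rwa [hll] at this
    exact (Finset.mem_filter.mp hx).2.symm.trans (Finset.mem_filter.mp hx').2

open Classical in
/-- The generating sum over partitions compatible with non-crossing labels `q` factorizes. -/
theorem sum_constOnParts_eq_prod [Fintype ι] (r : ℂ) {s : Finset α} (w : α → κ) {q : α → ι}
    (h : ∀ i ∈ s, ∀ j ∈ s, ∀ k ∈ s, ∀ l ∈ s, i < j → j < k → k < l → q i = q k → q j = q l →
      q i = q j) :
    ∑ π ∈ ncParts s, (if ConstOnParts q π then
        (if ConstOnParts w π then r ^ π.parts.card else 0) else 0) =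
      ∏ l : ι, coloredSum r (s.filter fun x => q x = l) w := by
  rw [← prod_fiberPartition s q (fun V => coloredSum r V w) (coloredSum_empty r w)]
  simp only [coloredSum]
  -- Compatibility with `q` means lying below the fibre partition, so the interval factorization
  -- applies.
  rw [← sum_ncParts_le_eq_prod (nonCrossing_fiberPartition h)
    (fun π => if ConstOnParts w π then r ^ π.parts.card else 0), Finset.sum_filter]
  · simp only [le_fiberPartition_iff]
  · intro Q
    by_cases hw : ConstOnParts w ((fiberPartition s q).bind Q)
    · rw [if_pos hw, Finpartition.card_bind, ← Finset.prod_pow_eq_pow_sum]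
      refine Finset.prod_congr rfl fun V _ => ?_
      rw [if_pos (constOnParts_bind.mp hw V.1 V.2)]
    · rw [if_neg hw]
      rw [constOnParts_bind] at hw
      push Not at hw
      obtain ⟨V, hV, hVw⟩ := hw
      exact (Finset.prod_eq_zero (Finset.mem_attach _ ⟨V, hV⟩) (if_neg hVw)).symm

end ColoredSums

/-! ### Alternating runs -/

section Runs

variable {κ : Type*} {m : ℕ}

/-- The positions in the runs with index in `s`, when the `j`-th run has length `k j`. -/
def runList (k : Fin m → ℕ) (s : Finset (Fin m)) : List (Fin m ×ₗ ℕ) :=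
  (List.finRange m).flatMap fun j =>
    if j ∈ s then (List.range (k j)).map fun n => toLex (j, n) else []

theorem mem_runList {k : Fin m → ℕ} {s : Finset (Fin m)} {x : Fin m ×ₗ ℕ} :
    x ∈ runList k s ↔ (ofLex x).1 ∈ s ∧ (ofLex x).2 < k (ofLex x).1 := by
  simp only [runList, List.mem_flatMap, List.mem_finRange, true_and]
  constructor
  · rintro ⟨j, hj⟩
    split_ifs at hj with hjs
    · simp only [List.mem_map, List.mem_range] at hj
      obtain ⟨n, hn, rfl⟩ := hj
      exact ⟨hjs, hn⟩
    · simp at hj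
  · rintro ⟨h1, h2⟩
    refine ⟨(ofLex x).1, ?_⟩
    rw [if_pos h1, List.mem_map]
    exact ⟨(ofLex x).2, List.mem_range.mpr h2, rfl⟩

theorem runList_pairwise (k : Fin m → ℕ) (s : Finset (Fin m)) :
    (runList k s).Pairwise (· < ·) := by
  rw [runList, List.pairwise_flatMap]
  constructor
  · intro j _
    split_ifs
    · rw [List.pairwise_map]
      refine List.pairwise_lt_range.imp fun h => ?_
      exact Prod.Lex.toLex_lt_toLex.mpr (Or.inr ⟨rfl, h⟩)
    · exact List.Pairwise.nil
  · refine (List.pairwise_lt_finRange m).imp fun {j j'} hjj x hx y hy => ?_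
    split_ifs at hx hy
    · simp only [List.mem_map] at hx hy
      obtain ⟨n, -, rfl⟩ := hx
      obtain ⟨n', -, rfl⟩ := hy
      exact Prod.Lex.toLex_lt_toLex.mpr (Or.inl hjj)
    all_goals simp at hx hy

/-- The set of positions in the runs with index in `s`. -/
def runSet (k : Fin m → ℕ) (s : Finset (Fin m)) : Finset (Fin m ×ₗ ℕ) := (runList k s).toFinset

theorem mem_runSet {k : Fin m → ℕ} {s : Finset (Fin m)} {x : Fin m ×ₗ ℕ} :
    x ∈ runSet k s ↔ (ofLex x).1 ∈ s ∧ (ofLex x).2 < k (ofLex x).1 := by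
  rw [runSet, List.mem_toFinset, mem_runList]

theorem sort_runSet (k : Fin m → ℕ) (s : Finset (Fin m)) : (runSet k s).sort = runList k s := by
  have h := runList_pairwise k s
  exact (List.toFinset_sort (· ≤ ·) (h.imp ne_of_lt)).mpr (h.imp le_of_lt)

/-- The words obtained by deleting some of the runs are all realized on subsets of one
lexicographically ordered set of positions. -/
theorem wordSum_runs (r : ℂ) (i : Fin m → κ) (k : Fin m → ℕ) (s : Finset (Fin m)) :
    wordSum r ((List.finRange m).flatMap fun j =>
      if j ∈ s then List.replicate (k j) (i j) else []) =
      coloredSum r (runSet k s) (fun x => i (ofLex x).1) := by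
  rw [← wordSum_sort, sort_runSet, runList, List.map_flatMap]
  congr 2
  funext j
  split_ifs
  · rw [List.map_map]
    exact List.eq_replicate_iff.mpr ⟨by simp, by simp⟩ |>.symm
  · rfl

/-- In a non-crossing partition whose blocks are monochromatic, one of the runs of an alternating
colouring is a union of blocks. -/
theorem exists_isolated_run {i : Fin m → κ} {k : Fin m → ℕ} (hm : 0 < m)
    (hi : ∀ j j' : Fin m, j'.val = j.val + 1 → i j ≠ i j')
    {π : Finpartition (runSet k Finset.univ)} (hπ : NonCrossing π)
    (hc : ConstOnParts (fun x => i (ofLex x).1) π) :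
    ∃ j, ConstOnParts (fun x => (ofLex x).1 = j) π := by
  by_contra hcon
  push Not at hcon
  have hne : ∀ j, ∃ V ∈ π.parts, ∃ x ∈ V, ∃ y ∈ V, (ofLex x).1 = j ∧ (ofLex y).1 ≠ j := by
    intro j
    have := hcon j
    rw [ConstOnParts] at this
    push Not at this
    obtain ⟨V, hV, x, hx, y, hy, hxy⟩ := this
    by_cases h : (ofLex x).1 = j
    · exact ⟨V, hV, x, hx, y, hy, h, fun h' => hxy (by simp [h, h'])⟩
    · by_cases h' : (ofLex y).1 = j
      · exact ⟨V, hV, y, hy, x, hx, h', h⟩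
      · exact absurd (by simp [h, h']) hxy
  -- By contradiction, every run shares a block with another run. Choose `u`, `v` in one block `V`
  -- at minimal positive run distance. The run `j₀` following that of `u` has another colour, so it
  -- lies strictly between them and is linked to some other run by a block `W ≠ V`.
  let P : ℕ → Prop := fun d => ∃ V ∈ π.parts, ∃ u ∈ V, ∃ v ∈ V,
    (ofLex u).1.val < (ofLex v).1.val ∧ (ofLex v).1.val - (ofLex u).1.val = d
  have hP : ∃ d, P d := by
    obtain ⟨V, hV, x, hx, y, hy, hx0, hy0⟩ := hne ⟨0, hm⟩
    refine ⟨_, V, hV, x, hx, y, hy, ?_, rfl⟩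
    rw [hx0]
    rcases Nat.eq_zero_or_pos (ofLex y).1.val with h | h
    · exact absurd (Fin.ext h) hy0
    · exact h
  classical
  obtain ⟨V, hV, u, hu, v, hv, huv, hd⟩ := Nat.find_spec hP
  have hmin := fun {d} => Nat.find_min hP (m := d)
  rw [← hd] at hmin
  have hvlt := (ofLex v).1.isLt
  let j₀ : Fin m := ⟨(ofLex u).1.val + 1, by omega⟩
  have hju : i (ofLex u).1 ≠ i j₀ := hi _ _ rfl
  have hcuv : i (ofLex u).1 = i (ofLex v).1 := hc V hV u hu v hv
  have hj₀v : j₀.val < (ofLex v).1.val := by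
    rcases Nat.lt_or_ge j₀.val (ofLex v).1.val with h | h
    · exact h
    · have : j₀ = (ofLex v).1 := Fin.ext (le_antisymm huv h)
      exact absurd (this ▸ hcuv) hju
  obtain ⟨W, hW, x, hx, y, hy, hx0, hy0⟩ := hne j₀
  have hcxy : i (ofLex x).1 = i (ofLex y).1 := hc W hW x hx y hy
  have hux : u < x := Prod.Lex.lt_iff.mpr (Or.inl (by rw [hx0, Fin.lt_def]; simp [j₀]))
  have hxv : x < v := Prod.Lex.lt_iff.mpr (Or.inl (by rw [hx0]; exact hj₀v))
  have hVW : V ≠ W := by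
    rintro rfl
    exact hju (hx0 ▸ hc V hV u hu x hx)
  have hyu : (ofLex y).1 ≠ (ofLex u).1 := by
    intro h
    rw [h, hx0] at hcxy
    exact hju hcxy.symm
  have hyv : (ofLex y).1 ≠ (ofLex v).1 := by
    intro h
    rw [h, hx0, ← hcuv] at hcxy
    exact hju hcxy.symm
  -- If `y` lies before the run of `u` or after that of `v`, then `W` crosses `V`; if it lies
  -- between, `x` and `y` contradict minimality.
  rcases lt_or_gt_of_ne hyu with h | h
  · exact hVW (hπ y u x v (Prod.Lex.lt_iff.mpr (Or.inl h)) hux hxv W hW V hV hy hx hu hv).symm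
  rcases lt_or_gt_of_ne hyv with h' | h'
  · have hxval : (ofLex x).1.val = (ofLex u).1.val + 1 := by rw [hx0]
    have hyx : (ofLex y).1.val ≠ (ofLex u).1.val + 1 := fun h => hy0 (Fin.ext h)
    rw [Fin.lt_def] at h h'
    refine hmin (d := (ofLex y).1.val - (ofLex x).1.val) (by omega)
      ⟨W, hW, x, hx, y, hy, by omega, rfl⟩
  · exact hVW (hπ u x v y hux hxv (Prod.Lex.lt_iff.mpr (Or.inl h')) V hV W hW hu hv hx hy)

end Runs

/-! ### Inclusion-exclusion over isolated runs -/

section InclusionExclusion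

variable {κ : Type*} {m : ℕ}

theorem fst_le_of_lt {x y : Fin m ×ₗ ℕ} (h : x < y) : (ofLex x).1 ≤ (ofLex y).1 := by
  rcases Prod.Lex.lt_iff.mp h with h | h
  · exact h.le
  · exact h.1.le

theorem wordSum_run (r : ℂ) (i : Fin m → κ) (k : Fin m → ℕ) (j : Fin m) :
    coloredSum r (runSet k {j}) (fun x => i (ofLex x).1) =
      wordSum r (List.replicate (k j) (i j)) := by
  let e : Fin (k j) ↪o Fin m ×ₗ ℕ := OrderEmbedding.ofStrictMono (fun n => toLex (j, n.val))
    fun _ _ h => Prod.Lex.toLex_lt_toLex.mpr (Or.inr ⟨rfl, h⟩)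
  have he : Finset.univ.map e.toEmbedding = runSet k {j} := by
    ext x
    simp only [Finset.mem_map, Finset.mem_univ, true_and, mem_runSet, Finset.mem_singleton]
    constructor
    · rintro ⟨n, rfl⟩
      exact ⟨rfl, n.isLt⟩
    · rintro ⟨h1, h2⟩
      subst h1
      exact ⟨⟨(ofLex x).2, h2⟩, rfl⟩
  rw [coloredSum_map r e he, ← List.ofFn_const, wordSum_ofFn]
  rfl

-- Label a position by its run if the run is outside `s`, and by `none` otherwise. Each label other
-- than `none` occupies an interval, so labels cannot cross and the sum factorizes over them.
open Classical in
theorem sum_isolated_runs (r : ℂ) (i : Fin m → κ) (k : Fin m → ℕ) (s : Finset (Fin m)) :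
    ∑ π ∈ ncParts (runSet k Finset.univ),
      (if ∀ j ∈ sᶜ, ConstOnParts (fun x => (ofLex x).1 = j) π then
        (if ConstOnParts (fun x => i (ofLex x).1) π then r ^ π.parts.card else 0) else 0) =
      (∏ j ∈ sᶜ, wordSum r (List.replicate (k j) (i j))) *
        coloredSum r (runSet k s) (fun x => i (ofLex x).1) := by
  let q : Fin m ×ₗ ℕ → Option (Fin m) := fun x =>
    if (ofLex x).1 ∈ s then none else some (ofLex x).1
  have hq : ∀ π : Finpartition (runSet k Finset.univ),
      (∀ j ∈ sᶜ, ConstOnParts (fun x => (ofLex x).1 = j) π) ↔ ConstOnParts q π := by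
    intro π
    constructor
    · intro h V hV x hx y hy
      simp only [q]
      by_cases hxs : (ofLex x).1 ∈ s
      · by_cases hys : (ofLex y).1 ∈ s
        · rw [if_pos hxs, if_pos hys]
        · have := h _ (Finset.mem_compl.mpr hys) V hV x hx y hy
          simp only [eq_iff_iff, iff_true] at this
          exact absurd (this ▸ hxs) hys
      · have := h _ (Finset.mem_compl.mpr hxs) V hV x hx y hy
        simp only [eq_iff_iff, true_iff] at this
        rw [this]
    · intro h j hj V hV x hx y hy
      have := h V hV x hx y hy
      rw [Finset.mem_compl] at hj
      simp only [q] at this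
      rw [eq_iff_iff]
      constructor
      · intro hxj
        rw [if_neg (hxj ▸ hj), hxj] at this
        split_ifs at this
        exact (Option.some.inj this).symm
      · intro hyj
        rw [if_neg (show (ofLex y).1 ∉ s from hyj ▸ hj), hyj] at this
        split_ifs at this
        exact Option.some.inj this
  simp only [hq]
  rw [sum_constOnParts_eq_prod r (fun x => i (ofLex x).1) (q := q), Fintype.prod_option, mul_comm]
  · congr 1
    · rw [← Finset.prod_subset (Finset.subset_univ sᶜ)]
      · refine Finset.prod_congr rfl fun j hj => ?_
        rw [← wordSum_run]
        congr 1
        ext x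
        rw [Finset.mem_compl] at hj
        simp only [Finset.mem_filter, mem_runSet, Finset.mem_univ, true_and, q,
          Finset.mem_singleton]
        constructor
        · rintro ⟨h1, h2⟩
          split_ifs at h2
          exact ⟨Option.some.inj h2, h1⟩
        · rintro ⟨h1, h2⟩
          rw [h1, if_neg hj]
          exact ⟨h1 ▸ h2, rfl⟩
      · intro j _ hj
        rw [Finset.mem_compl, not_not] at hj
        refine (congrArg (fun V => coloredSum r V _) ?_).trans (coloredSum_empty r _)
        refine Finset.eq_empty_of_forall_notMem fun x hx => ?_
        simp only [Finset.mem_filter, q] at hx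
        replace hx := hx.2
        split_ifs at hx with h
        exact h (Option.some.inj hx ▸ hj)
    · congr 1
      ext x
      simp only [Finset.mem_filter, mem_runSet, Finset.mem_univ, true_and, q]
      constructor
      · rintro ⟨h1, h2⟩
        split_ifs at h2 with h
        exact ⟨h, h1⟩
      · rintro ⟨h1, h2⟩
        exact ⟨h2, if_pos h1⟩
  · intro x _ y _ z _ t _ hxy hyz hzt hxz hyt
    have h1 := fst_le_of_lt hxy
    have h2 := fst_le_of_lt hyz
    have h3 := fst_le_of_lt hzt
    simp only [q] at hxz hyt ⊢
    by_cases hx : (ofLex x).1 ∈ s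
    · rw [if_pos hx] at hxz
      by_cases hy : (ofLex y).1 ∈ s
      · rw [if_pos hx, if_pos hy]
      · rw [if_neg hy] at hyt
        split_ifs at hyt with ht
        have hyt := Option.some.inj hyt
        have : (ofLex z).1 = (ofLex y).1 := le_antisymm (h3.trans hyt.ge) h2
        rw [this, if_neg hy] at hxz
        simp at hxz
    · rw [if_neg hx] at hxz
      split_ifs at hxz with hz
      have hxz := Option.some.inj hxz
      have : (ofLex y).1 = (ofLex x).1 := le_antisymm (h2.trans hxz.ge) h1
      rw [this]

/-- The generating sums satisfy the relation that expresses freeness. -/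
theorem sum_runs_eq_zero (r : ℂ) {i : Fin m → κ} (k : Fin m → ℕ) (hm : 0 < m)
    (hi : ∀ j j' : Fin m, j'.val = j.val + 1 → i j ≠ i j') :
    ∑ s : Finset (Fin m), (∏ j ∈ sᶜ, -wordSum r (List.replicate (k j) (i j))) *
      coloredSum r (runSet k s) (fun x => i (ofLex x).1) = 0 := by
  classical
  -- The term of `s` is a signed sum over the partitions in which every run outside `s` is a union
  -- of blocks.
  have h1 : ∀ s : Finset (Fin m), (∏ j ∈ sᶜ, -wordSum r (List.replicate (k j) (i j))) *
      coloredSum r (runSet k s) (fun x => i (ofLex x).1) =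
      ∑ π ∈ ncParts (runSet k Finset.univ),
        (if ConstOnParts (fun x => i (ofLex x).1) π then r ^ π.parts.card else 0) *
        ((∏ j ∈ s, (1 : ℂ)) *
          ∏ j ∈ sᶜ, if ConstOnParts (fun x => (ofLex x).1 = j) π then (-1 : ℂ) else 0) := by
    intro s
    rw [Finset.prod_neg, mul_assoc, ← sum_isolated_runs, Finset.mul_sum]
    refine Finset.sum_congr rfl fun π _ => ?_
    rw [Finset.prod_const_one, one_mul, Finset.prod_ite_zero, Finset.prod_const]
    by_cases h : ∀ j ∈ sᶜ, ConstOnParts (fun x => (ofLex x).1 = j) π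
    · rw [if_pos h, if_pos h, mul_comm]
    · rw [if_neg h, if_neg h, mul_zero, mul_zero]
  simp only [h1]
  rw [Finset.sum_comm]
  refine Finset.sum_eq_zero fun π hπ => ?_
  -- Summing over `s` gives the product over all runs of `1 - [run isolated]`, which vanishes
  -- because some run is isolated.
  rw [← Finset.mul_sum, ← Fintype.prod_add]
  split_ifs with hc
  · obtain ⟨j, hj⟩ := exists_isolated_run hm hi (mem_ncParts.mp hπ) hc
    rw [Finset.prod_eq_zero (Finset.mem_univ j), mul_zero]
    rw [if_pos hj]
    ring
  · rw [zero_mul]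

end InclusionExclusion

/-! ### Uniqueness of free functionals -/

section Uniqueness

variable {κ B : Type*} [Ring B] [Algebra ℂ B]

/-- The centred power `x ^ k - μ`. -/
noncomputable def centeredPow (X : κ → B) (μ : κ → ℕ → ℂ) (p : κ × ℕ) : B :=
  X p.1 ^ p.2 - algebraMap ℂ B (μ p.1 p.2)

/-- A functional that vanishes at `1` and at all alternating products of centred powers vanishes
at all words. -/
theorem eq_zero_of_centered (X : κ → B) (μ : κ → ℕ → ℂ) (D : B →ₗ[ℂ] ℂ)
    (hD : ∀ M : List (κ × ℕ), M.IsChain (fun p q => p.1 ≠ q.1) →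
      D (M.map (centeredPow X μ)).prod = 0) (L : List κ) :
    D (L.map X).prod = 0 := by
  -- The generalized claim allows a word to be consumed from the right, its last letter being
  -- absorbed into the alternating product.
  suffices h : ∀ M : List (κ × ℕ), M.IsChain (fun p q => p.1 ≠ q.1) →
      D ((L.map X).prod * (M.map (centeredPow X μ)).prod) = 0 by
    simpa using h [] List.isChain_nil
  induction L using List.reverseRecOn with
  | nil => intro M hM; simpa using hD M hM
  | append_singleton L t ih =>
    have hX : ∀ k, X t ^ k = centeredPow X μ (t, k) + algebraMap ℂ B (μ t k) := by
      intro k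
      simp [centeredPow]
    have hX1 : X t = centeredPow X μ (t, 1) + algebraMap ℂ B (μ t 1) := by simpa using hX 1
    -- If the letter differs from the first letter of `M`, its centred version prolongs the
    -- alternating product and the constant leaves `M` unchanged.
    have key : ∀ M : List (κ × ℕ), M.IsChain (fun p q => p.1 ≠ q.1) → (∀ p ∈ M.head?, t ≠ p.1) →
        D ((L.map X).prod * (X t * (M.map (centeredPow X μ)).prod)) = 0 := by
      intro M hM hh
      have h1 := ih ((t, 1) :: M) (List.isChain_cons.mpr ⟨fun p hp => hh p hp, hM⟩)
      have h2 := ih M hM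
      rw [List.map_cons, List.prod_cons] at h1
      rw [hX1, add_mul, mul_add, map_add, h1, ← Algebra.smul_def, mul_smul_comm, map_smul, h2]
      simp
    intro M hM
    rw [List.map_append, List.prod_append, List.map_singleton, List.prod_singleton, mul_assoc]
    rcases M with _ | ⟨⟨t', k⟩, M⟩
    · exact key [] hM (by simp)
    · by_cases ht : t = t'
      · subst ht
        rw [List.isChain_cons] at hM
        have h1 := ih ((t, k + 1) :: M) (List.isChain_cons.mpr hM)
        have h2 := ih M hM.2
        have h3 := key M hM.2 hM.1
        rw [List.map_cons, List.prod_cons] at h1 ⊢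
        -- Equal letters merge: `X(X^k - μ_k) = (X^(k+1) - μ_(k+1)) + μ_(k+1) - μ_k X`. In the last
        -- term `X` meets a tail starting with a different letter, so `key` applies.
        have : X t * (centeredPow X μ (t, k) * (M.map (centeredPow X μ)).prod) =
            centeredPow X μ (t, k + 1) * (M.map (centeredPow X μ)).prod +
            μ t (k + 1) • (M.map (centeredPow X μ)).prod -
            μ t k • (X t * (M.map (centeredPow X μ)).prod) := by
          simp only [centeredPow, Algebra.smul_def, sub_mul, mul_sub, pow_succ', mul_assoc]
          rw [← mul_assoc (X t) (algebraMap ℂ B _), ← Algebra.commutes, mul_assoc]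
          abel
        rw [this, mul_sub, mul_add, map_sub, map_add, h1, mul_smul_comm, mul_smul_comm, map_smul,
          map_smul, h2, h3]
        simp
      · exact key _ hM (by simpa using ht)

end Uniqueness

/-! ### Mixed moments of free elements -/

section MixedMoments

variable {κ : Type*}

/-- The linear functional on non-commutative polynomials that maps each word to its generating
sum. -/
noncomputable def wordFunctional (κ : Type*) (r : ℂ) :
    MonoidAlgebra ℂ (FreeMonoid κ) →ₗ[ℂ] ℂ where
  toFun f := Finsupp.linearCombination ℂ (fun L : FreeMonoid κ => wordSum r L.toList) f.coeff
  map_add' f g := by rw [MonoidAlgebra.coeff_add, map_add]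
  map_smul' c f := by rw [MonoidAlgebra.coeff_smul, map_smul]; rfl

/-- The variables of the non-commutative polynomial ring. -/
noncomputable def ncVar (t : κ) : MonoidAlgebra ℂ (FreeMonoid κ) :=
  MonoidAlgebra.of ℂ _ (FreeMonoid.of t)

theorem wordFunctional_of (r : ℂ) (L : FreeMonoid κ) :
    wordFunctional κ r (MonoidAlgebra.of ℂ _ L) = wordSum r L.toList := by
  simp [wordFunctional]

theorem toList_of_pow (t : κ) (k : ℕ) :
    (FreeMonoid.of t ^ k).toList = List.replicate k t := by
  induction k with
  | zero => rfl
  | succ k ih => rw [pow_succ', FreeMonoid.toList_of_mul, ih, List.replicate_succ]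

/-- Expanding each factor as a power minus a constant gives exactly the sum in `sum_runs_eq_zero`;
`s` records the factors that contribute their power. -/
theorem wordFunctional_centered_ofFn (r : ℂ) {m : ℕ} {i : Fin m → κ} (k : Fin m → ℕ) (hm : 0 < m)
    (hi : ∀ j j' : Fin m, j'.val = j.val + 1 → i j ≠ i j') :
    wordFunctional κ r (List.ofFn fun j =>
      centeredPow ncVar (fun t k => wordSum r (List.replicate k t)) (i j, k j)).prod = 0 := by
  classical
  let a : Fin m → MonoidAlgebra ℂ (FreeMonoid κ) := fun j => ncVar (i j) ^ k j
  let c : Fin m → ℂ := fun j => -wordSum r (List.replicate (k j) (i j))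
  let b : Fin m → MonoidAlgebra ℂ (FreeMonoid κ) := fun j => c j • 1
  have hab : (fun j => centeredPow ncVar (fun t k => wordSum r (List.replicate k t)) (i j, k j)) =
      a + b := by
    funext j
    simp only [centeredPow, Pi.add_apply, a, b, c, neg_smul, Algebra.algebraMap_eq_smul_one,
      sub_eq_add_neg]
  rw [hab, ← MultilinearMap.mkPiAlgebraFin_apply (R := ℂ), MultilinearMap.map_add_univ, map_sum,
    ← sum_runs_eq_zero r k hm hi]
  refine Finset.sum_congr rfl fun s _ => ?_
  have hpw : s.piecewise a b = sᶜ.piecewise (fun j => c j • s.piecewise a 1 j) (s.piecewise a 1) := by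
    funext j
    by_cases hj : j ∈ s <;> simp [Finset.piecewise, hj, b]
  rw [hpw, MultilinearMap.map_piecewise_smul, map_smul, smul_eq_mul,
    MultilinearMap.mkPiAlgebraFin_apply, ← wordSum_runs]
  congr 1
  have hw : s.piecewise a 1 = fun j => MonoidAlgebra.of ℂ _
      (if j ∈ s then FreeMonoid.of (i j) ^ k j else 1) := by
    funext j
    by_cases hj : j ∈ s
    · simp only [Finset.piecewise, if_pos hj, a, map_pow, ncVar]
    · simp only [Finset.piecewise, if_neg hj, map_one, Pi.one_apply]
  have hl : (List.ofFn (s.piecewise a 1)).prod = MonoidAlgebra.of ℂ _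
      (List.ofFn fun j => if j ∈ s then FreeMonoid.of (i j) ^ k j else 1).prod := by
    rw [hw, map_list_prod, List.map_ofFn]
    rfl
  rw [hl, wordFunctional_of, FreeMonoid.toList_prod, List.map_ofFn, List.ofFn_eq_map,
    ← List.flatMap_def]
  congr 2
  funext j
  simp only [Function.comp_apply]
  split_ifs
  · exact toList_of_pow _ _
  · rfl

theorem isChain_getElem_ne {M : List (κ × ℕ)} (hM : M.IsChain fun p q => p.1 ≠ q.1)
    {j j' : Fin M.length} (h : j'.val = j.val + 1) : (M.get j).1 ≠ (M.get j').1 := by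
  have h1 := List.isChain_iff_getElem.mp hM j.val (by omega)
  have h2 : M.get j' = M[j.val + 1]'(by omega) := by
    rw [List.get_eq_getElem]
    congr 1
  rw [h2]
  exact h1

variable {A : Type*} [Ring A] [Algebra ℂ A]

/-- The mixed moments of two free elements with free Poisson distribution of parameter `r`. -/
theorem moment_word {φ : A →ₗ[ℂ] ℂ} (hφ : φ 1 = 1) {a b : A} (hab : Free φ a b) {r : ℂ}
    (ha : IsFreePoisson φ r a) (hb : IsFreePoisson φ r b) (L : List (Fin 2)) :
    φ (L.map ![a, b]).prod = wordSum r L := by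
  set μ : Fin 2 → ℕ → ℂ := fun t k => wordSum r (List.replicate k t) with hμ
  let ev : MonoidAlgebra ℂ (FreeMonoid (Fin 2)) →ₐ[ℂ] A :=
    MonoidAlgebra.lift ℂ A (FreeMonoid (Fin 2)) (FreeMonoid.lift ![a, b])
  have hev : ∀ t, ev (ncVar t) = ![a, b] t := by
    intro t
    rw [ncVar, MonoidAlgebra.lift_of, FreeMonoid.lift_eval_of]
  have hmom : ∀ t k, φ (![a, b] t ^ k) = μ t k := by
    intro t k
    rw [hμ]
    simp only
    rw [wordSum_replicate]
    fin_cases t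
    · exact moment_eq_sum_of_isFreePoisson hφ ha k
    · exact moment_eq_sum_of_isFreePoisson hφ hb k
  have hadj : ∀ t, ![a, b] t ∈ ![Algebra.adjoin ℂ {a}, Algebra.adjoin ℂ {b}] t := by
    intro t
    fin_cases t
    · exact Algebra.self_mem_adjoin_singleton ℂ a
    · exact Algebra.self_mem_adjoin_singleton ℂ b
  have hcen : ∀ p, ev (centeredPow ncVar μ p) = centeredPow ![a, b] μ p := by
    intro p
    rw [centeredPow, centeredPow, map_sub, map_pow, hev, AlgHom.commutes]
  have hword : wordFunctional (Fin 2) r (L.map ncVar).prod = wordSum r L := by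
    have : (L.map ncVar).prod =
        MonoidAlgebra.of ℂ (FreeMonoid (Fin 2)) (FreeMonoid.ofList L) := by
      induction L with
      | nil => rfl
      | cons t L ih => rw [List.map_cons, List.prod_cons, ih, FreeMonoid.ofList_cons, map_mul]; rfl
    rw [this, wordFunctional_of, FreeMonoid.toList_ofList]
  -- Both functionals are `1` at `1` and have the same one-variable moments `μ`. On nonempty
  -- alternating centred products the first vanishes by freeness of `a` and `b`, the second by
  -- inclusion-exclusion.
  have key := eq_zero_of_centered ncVar μ (φ ∘ₗ ev.toLinearMap - wordFunctional (Fin 2) r) ?_ L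
  · rw [LinearMap.sub_apply, sub_eq_zero, LinearMap.comp_apply, AlgHom.toLinearMap_apply, hword,
      map_list_prod, List.map_map] at key
    rw [← key]
    congr 3
    funext t
    exact (hev t).symm
  · intro M hM
    rw [LinearMap.sub_apply, LinearMap.comp_apply, AlgHom.toLinearMap_apply]
    rcases M with _ | ⟨p, M⟩
    · have h1 : wordFunctional (Fin 2) r (MonoidAlgebra.of ℂ _ 1) = 1 := by
        rw [wordFunctional_of]
        exact coloredSum_empty r _
      rw [map_one] at h1
      simp [hφ, h1]
    · have hM' : ((p :: M).map (centeredPow ncVar μ)) =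
          List.ofFn fun j => centeredPow ncVar μ (((p :: M).get j).1, ((p :: M).get j).2) := by
        rw [List.ofFn_eq_map]
        nth_rewrite 1 [← List.map_get_finRange (p :: M)]
        rw [List.map_map]
        rfl
      have h1 := wordFunctional_centered_ofFn r (i := fun j => ((p :: M).get j).1)
        (fun j => ((p :: M).get j).2) (Nat.succ_pos _) fun j j' h => isChain_getElem_ne hM h
      rw [← hM'] at h1
      rw [h1, sub_zero, hM', map_list_prod, List.map_ofFn]
      refine hab M.length (fun j => ((p :: M).get j).1) _ ?_ ?_ ?_
      · intro j
        exact isChain_getElem_ne hM rfl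
      · intro j
        rw [Function.comp_apply, hcen, centeredPow]
        exact sub_mem (pow_mem (hadj _) _) (Subalgebra.algebraMap_mem _ _)
      · intro j
        rw [Function.comp_apply, hcen, centeredPow]
        rw [map_sub, hmom, Algebra.algebraMap_eq_smul_one, map_smul, hφ, smul_eq_mul, mul_one,
          sub_self]

end MixedMoments

/-! ### Moments of the anti-commutator -/

section Pairs

variable {n : ℕ}

/-- The index of the pair that contains a given element of `[2n]`. -/
def half (x : Fin (2 * n)) : Fin n := ⟨x.val / 2, by omega⟩

@[simp] theorem half_pairFst (k : Fin n) : half (pairFst k) = k := by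
  ext; simp [half, pairFst]

@[simp] theorem half_pairSnd (k : Fin n) : half (pairSnd k) = k := by
  ext; simp [half, pairSnd]; omega

theorem eq_pairFst_or_eq_pairSnd (x : Fin (2 * n)) :
    x = pairFst (half x) ∨ x = pairSnd (half x) := by
  rcases Nat.mod_two_eq_zero_or_one x.val with h | h
  · left; ext; simp [half, pairFst]; omega
  · right; ext; simp [half, pairSnd]; omega

/-- The colouring takes different values on the two elements of each pair. -/
def IsProper (c : Fin (2 * n) → ZMod 2) : Prop := ∀ k : Fin n, c (pairSnd k) = c (pairFst k) + 1

/-- The proper colouring with given values on the first elements of the pairs. -/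
def properOf (ε : Fin n → ZMod 2) (x : Fin (2 * n)) : ZMod 2 := ε (half x) + (x.val : ZMod 2)

theorem properOf_pairFst (ε : Fin n → ZMod 2) (k : Fin n) : properOf ε (pairFst k) = ε k := by
  rw [properOf, half_pairFst]
  simp only [pairFst, Nat.cast_mul, add_eq_left]
  rw [show ((2 : ℕ) : ZMod 2) = 0 from rfl, zero_mul]

theorem properOf_pairSnd (ε : Fin n → ZMod 2) (k : Fin n) : properOf ε (pairSnd k) = ε k + 1 := by
  rw [properOf, half_pairSnd]
  simp only [pairSnd, Nat.cast_add, Nat.cast_mul, Nat.cast_one, add_right_inj]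
  rw [show ((2 : ℕ) : ZMod 2) = 0 from rfl, zero_mul, zero_add]

open Classical in
theorem sum_properOf {R : Type*} [AddCommMonoid R] (F : (Fin (2 * n) → ZMod 2) → R) :
    ∑ ε : Fin n → ZMod 2, F (properOf ε) = ∑ c ∈ Finset.univ.filter IsProper, F c := by
  refine Finset.sum_bij' (fun ε _ => properOf ε) (fun c _ k => c (pairFst k)) ?_ ?_ ?_ ?_ ?_
  · intro ε _
    rw [Finset.mem_filter]
    exact ⟨Finset.mem_univ _, fun k => by rw [properOf_pairFst, properOf_pairSnd]⟩
  · intro c _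
    exact Finset.mem_univ _
  · intro ε _
    funext k
    exact properOf_pairFst ε k
  · intro c hc
    have hc := (Finset.mem_filter.mp hc).2
    funext x
    rcases eq_pairFst_or_eq_pairSnd x with h | h
    · rw [h, properOf_pairFst]
    · rw [h, properOf_pairSnd, hc]
  · intro ε _
    rfl

variable {A : Type*} [Ring A] [Algebra ℂ A]

/-- The anti-commutator is `∑ t, x t * x (t + 1)` over `ZMod 2`; choosing `t = ε k` in the `k`-th
factor spells the word of `properOf ε`. -/
theorem anticommutator_pow (x : ZMod 2 → A) (n : ℕ) :
    (x 0 * x 1 + x 1 * x 0) ^ n =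
      ∑ ε : Fin n → ZMod 2, (List.ofFn fun i => x (properOf ε i)).prod := by
  have h0 : x 0 * x 1 + x 1 * x 0 = ∑ t : ZMod 2, x t * x (t + 1) :=
    (Fin.sum_univ_two fun t : ZMod 2 => x t * x (t + 1)).symm
  rw [h0, ← MultilinearMap.mkPiAlgebraFin_apply_const (R := ℂ), MultilinearMap.map_sum]
  refine Finset.sum_congr rfl fun ε _ => ?_
  rw [MultilinearMap.mkPiAlgebraFin_apply, List.ofFn_mul', List.prod_flatten, List.map_ofFn]
  congr 2
  funext k
  have h1 := properOf_pairFst ε k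
  have h2 := properOf_pairSnd ε k
  simp only [pairFst, pairSnd] at h1 h2
  simp [List.ofFn_succ, h1, h2]

open Classical in
/-- The moments of the anti-commutator. -/
theorem moment_anticommutator {φ : A →ₗ[ℂ] ℂ} (hφ : φ 1 = 1) {a b : A} (hab : Free φ a b) {r : ℂ}
    (ha : IsFreePoisson φ r a) (hb : IsFreePoisson φ r b) (n : ℕ) :
    φ ((a * b + b * a) ^ n) = ∑ π ∈ NC (2 * n), r ^ π.parts.card *
      ((Finset.univ.filter fun c : Fin (2 * n) → ZMod 2 =>
        IsProper c ∧ ConstOnParts c π).card : ℂ) := by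
  let x : ZMod 2 → A := (![a, b] : Fin 2 → A)
  have h0 : a * b + b * a = x 0 * x 1 + x 1 * x 0 := rfl
  have h1 : ∀ c : Fin (2 * n) → ZMod 2,
      φ (List.ofFn fun i => x (c i)).prod = coloredSum r Finset.univ c := by
    intro c
    have h := moment_word hφ hab ha hb (List.ofFn (α := Fin 2) c)
    have e : (List.ofFn (α := Fin 2) c).map ![a, b] = List.ofFn fun i => x (c i) :=
      List.map_ofFn
    rw [← e]
    exact h.trans (wordSum_ofFn r c)
  rw [h0, anticommutator_pow, map_sum, Finset.sum_congr rfl fun ε _ => h1 (properOf ε),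
    sum_properOf, NC_eq_ncParts]
  simp only [coloredSum]
  rw [Finset.sum_comm]
  refine Finset.sum_congr rfl fun π _ => ?_
  rw [← Finset.sum_filter, Finset.sum_const, Finset.filter_filter, nsmul_eq_mul, mul_comm]

/-! ### Connected components -/

/-- The colouring takes equal values on the two elements of each pair inside `V`. -/
def PairConst (V : Finset (Fin (2 * n))) (c : Fin (2 * n) → ZMod 2) : Prop :=
  ∀ k : Fin n, pairFst k ∈ V → c (pairSnd k) = c (pairFst k)

/-- The blocks of `π` and the pairs in `V` together connect `V`. -/
def PairConnected {V : Finset (Fin (2 * n))} (π : Finpartition V) : Prop :=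
  ∀ c : Fin (2 * n) → ZMod 2, ConstOnParts c π → PairConst V c → ∀ x ∈ V, ∀ y ∈ V, c x = c y

/-- There is a two-colouring of the blocks of `π` with different colours on the two elements of
each pair in `V`. -/
def PairBipartite {V : Finset (Fin (2 * n))} (π : Finpartition V) : Prop :=
  ∃ c : Fin (2 * n) → ZMod 2, ConstOnParts c π ∧
    ∀ k : Fin n, pairFst k ∈ V → c (pairSnd k) = c (pairFst k) + 1

theorem PairConst.eq_half {c : Fin (2 * n) → ZMod 2} (hc : PairConst Finset.univ c)
    (x : Fin (2 * n)) : c x = c (pairFst (half x)) := by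
  rcases eq_pairFst_or_eq_pairSnd x with h | h
  · rw [← h]
  · rw [← hc _ (Finset.mem_univ _), ← h]

/-- Two pairs are equivalent if no colouring that is constant on blocks and pairs separates
them. -/
def compSetoid (π : SetPartition (2 * n)) : Setoid (Fin n) where
  r k l := ∀ c : Fin (2 * n) → ZMod 2, ConstOnParts c π → PairConst Finset.univ c →
    c (pairFst k) = c (pairFst l)
  iseqv := ⟨fun _ _ _ _ => rfl, fun h c h1 h2 => (h c h1 h2).symm,
    fun h h' c h1 h2 => (h c h1 h2).trans (h' c h1 h2)⟩

open Classical in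
/-- The partition of the set of pairs into connected components. -/
noncomputable def comp (π : SetPartition (2 * n)) : SetPartition n :=
  Finpartition.ofSetoid (compSetoid π)

theorem comp_part_eq_iff {π : SetPartition (2 * n)} {k l : Fin n} :
    (comp π).part k = (comp π).part l ↔ ∀ c : Fin (2 * n) → ZMod 2, ConstOnParts c π →
      PairConst Finset.univ c → c (pairFst k) = c (pairFst l) := by
  classical
  rw [← Finpartition.mem_part_iff_part_eq_part _ (Finset.mem_univ _) (Finset.mem_univ _), comp,
    Finpartition.mem_part_ofSetoid_iff_rel]
  exact ⟨fun h c h1 h2 => (h c h1 h2).symm, fun h c h1 h2 => (h c h1 h2).symm⟩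

/-- The partition of `[2n]` whose blocks are the unions of the pairs in the blocks of `ρ`. -/
noncomputable def doublePartition (ρ : SetPartition n) : SetPartition (2 * n) :=
  fiberPartition Finset.univ fun x => ρ.part (half x)

theorem le_doublePartition_iff {π : SetPartition (2 * n)} {ρ : SetPartition n} :
    π ≤ doublePartition ρ ↔ ConstOnParts (fun x => ρ.part (half x)) π :=
  le_fiberPartition_iff

theorem le_double_comp (π : SetPartition (2 * n)) : π ≤ doublePartition (comp π) := by
  rw [le_doublePartition_iff]
  intro V hV x hx y hy
  rw [comp_part_eq_iff]
  intro c hc hp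
  rw [← hp.eq_half, ← hp.eq_half]
  exact hc V hV x hx y hy

/-- The first condition says that no component is larger than a block of `ρ`, the second that none
is smaller. Indicators of blocks of `ρ` serve as test colourings. -/
theorem comp_eq_iff {π : SetPartition (2 * n)} {ρ : SetPartition n} :
    comp π = ρ ↔ π ≤ doublePartition ρ ∧ ∀ c : Fin (2 * n) → ZMod 2, ConstOnParts c π →
      PairConst Finset.univ c → ∀ k l, ρ.part k = ρ.part l → c (pairFst k) = c (pairFst l) := by
  classical
  constructor
  · rintro rfl
    exact ⟨le_double_comp π, fun c h1 h2 k l hkl => comp_part_eq_iff.mp hkl c h1 h2⟩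
  · rintro ⟨hle, h⟩
    refine finpartition_ext_part fun k _ l _ => ?_
    rw [comp_part_eq_iff]
    constructor
    · intro hkl
      have h1 := hkl (fun x => if ρ.part (half x) = ρ.part k then 1 else 0) ?_ ?_
      · simp only [half_pairFst, if_true] at h1
        by_contra hne
        rw [if_neg (Ne.symm hne)] at h1
        exact one_ne_zero h1
      · intro V hV x hx y hy
        simp only
        rw [show ρ.part (half x) = ρ.part (half y) from
          le_doublePartition_iff.mp hle V hV x hx y hy]
      · intro j _
        simp
    · intro hkl c h1 h2
      exact h c h1 h2 k l hkl

/-- Otherwise the indicator of the elements of the pairs of `V` strictly between `p` and `q` would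
be constant on blocks. It is constant on pairs, since `p` and `q` lie in pairs outside `V` and so
cut no pair of `V`. But it separates `x` from `y`, which lie in one component. -/
theorem exists_block_crossing {π : SetPartition (2 * n)} {V : Finset (Fin n)}
    (hV : V ∈ (comp π).parts) {p q x y : Fin (2 * n)} (hp : half p ∉ V) (hq : half q ∉ V)
    (hx : half x ∈ V) (hy : half y ∈ V) (hpx : p < x) (hxq : x < q) (hyq : ¬ (p < y ∧ y < q)) :
    ∃ U ∈ π.parts, ∃ u ∈ U, ∃ v ∈ U, half u ∈ V ∧ half v ∈ V ∧ p < u ∧ u < q ∧ (v < p ∨ q < v) := by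
  classical
  by_contra hcon
  push Not at hcon
  have hUV : ∀ U ∈ π.parts, ∀ u ∈ U, ∀ v ∈ U, half u ∈ V → half v ∈ V := by
    intro U hU u hu v hv huV
    have := le_doublePartition_iff.mp (le_double_comp π) U hU u hu v hv
    simp only at this
    rw [(comp π).part_eq_of_mem hV huV] at this
    rw [this]
    exact (comp π).mem_part (Finset.mem_univ _)
  have hxy : (comp π).part (half x) = (comp π).part (half y) := by
    rw [(comp π).part_eq_of_mem hV hx, (comp π).part_eq_of_mem hV hy]
  let c : Fin (2 * n) → ZMod 2 := fun z => if half z ∈ V ∧ p < z ∧ z < q then 1 else 0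
  have hcp : PairConst Finset.univ c := by
    intro k _
    simp only [c, half_pairFst, half_pairSnd]
    congr 1
    rw [eq_iff_iff]
    refine and_congr_right fun hk => ?_
    have h1 : half p ≠ k := fun h => hp (h ▸ hk)
    have h2 : half q ≠ k := fun h => hq (h ▸ hk)
    simp only [ne_eq, Fin.ext_iff, half] at h1 h2
    simp only [Fin.lt_def, pairFst, pairSnd]
    omega
  have hcc : ConstOnParts c π := by
    have h1 : ∀ U ∈ π.parts, ∀ u ∈ U, ∀ v ∈ U, (half u ∈ V ∧ p < u ∧ u < q) →
        (half v ∈ V ∧ p < v ∧ v < q) := by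
      rintro U hU u hu v hv ⟨h1, h2, h3⟩
      have hvV := hUV U hU u hu v hv h1
      have h4 := hcon U hU u hu v hv h1 hvV h2 h3
      refine ⟨hvV, lt_of_le_of_ne h4.1 ?_, lt_of_le_of_ne h4.2 ?_⟩
      · rintro rfl; exact hp hvV
      · rintro rfl; exact hq hvV
    intro U hU u hu v hv
    simp only [c]
    congr 1
    exact propext ⟨h1 U hU u hu v hv, h1 U hU v hv u hu⟩
  have := comp_part_eq_iff.mp hxy c hcc hcp
  rw [← hcp.eq_half, ← hcp.eq_half] at this
  simp only [c] at this
  rw [if_pos ⟨hx, hpx, hxq⟩, if_neg fun h => hyq h.2] at this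
  exact one_ne_zero this

/-- The components of a non-crossing partition form a non-crossing partition. -/
theorem nonCrossing_comp {π : SetPartition (2 * n)} (hπ : NonCrossing π) :
    NonCrossing (comp π) := by
  intro i j k l hij hjk hkl V hV W hW hi hk hj hl
  by_contra hVW
  have hdisj : ∀ z, z ∈ V → z ∉ W := fun z hz hz' => hVW ((comp π).eq_of_mem_parts hV hW hz hz')
  rw [Fin.lt_def] at hij hjk hkl
  -- Crossing components `V` and `W`: since `k` is between `j` and `l` and `i` is not, some block
  -- `U` of the component `V` has points both inside and outside that interval.
  obtain ⟨U, hU, u, hu, v, hv, huV, hvV, hpu, huq, hv'⟩ :=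
    exists_block_crossing hV (p := pairFst j) (q := pairFst l) (x := pairFst k) (y := pairFst i)
      (by rw [half_pairFst]; exact fun h => hdisj j h hj)
      (by rw [half_pairFst]; exact fun h => hdisj l h hl)
      (by rwa [half_pairFst]) (by rwa [half_pairFst])
      (by simp only [Fin.lt_def, pairFst]; omega) (by simp only [Fin.lt_def, pairFst]; omega)
      (by simp only [Fin.lt_def, pairFst]; omega)
  -- Two points of `U` then separate `j` from `l`, so some block in `W` has to cross `U`.
  -- Non-crossing makes it equal to `U`, which lies in `V`.
  have key : ∀ s t : Fin (2 * n), s ∈ U → t ∈ U → half s ∈ V → half t ∈ V →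
      ∀ x y : Fin (2 * n), half x ∈ W → half y ∈ W → s < x → x < t → ¬ (s < y ∧ y < t) →
      False := by
    intro s t hs ht hsV htV x y hx hy hsx hxt hyt
    obtain ⟨U', hU', u', hu', v', hv', hu'W, -, hsu, hut, h⟩ :=
      exists_block_crossing hW (hdisj _ hsV) (hdisj _ htV) hx hy hsx hxt hyt
    have hUU : U = U' := by
      rcases h with h | h
      · exact (hπ v' s u' t h hsu hut U' hU' U hU hv' hu' hs ht).symm
      · exact hπ s u' t v' hsu hut h U hU U' hU' hs ht hu' hv'
    subst hUU
    have := le_doublePartition_iff.mp (le_double_comp π) U hU s hs u' hu'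
    simp only at this
    rw [(comp π).part_eq_of_mem hV hsV, (comp π).part_eq_of_mem hW hu'W] at this
    exact hVW this
  rcases hv' with h | h
  · exact key v u hv hu hvV huV (pairFst j) (pairFst l) (by rwa [half_pairFst])
      (by rwa [half_pairFst]) h hpu (fun h => absurd h.2 (not_lt.mpr huq.le))
  · exact key u v hu hv huV hvV (pairFst l) (pairFst j) (by rwa [half_pairFst])
      (by rwa [half_pairFst]) huq h (fun h => absurd h.1 (not_lt.mpr hpu.le))

end Pairs

/-! ### Factorization of the moments over connected components -/

section Components

variable {n : ℕ}

theorem mem_doublePartition {ρ : SetPartition n} {V : Finset (Fin (2 * n))} :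
    V ∈ (doublePartition ρ).parts ↔ ∃ U ∈ ρ.parts, Finset.univ.filter (fun x => half x ∈ U) = V := by
  classical
  rw [doublePartition, mem_fiberPartition]
  constructor
  · rintro ⟨x, -, rfl⟩
    refine ⟨ρ.part (half x), ρ.part_mem.mpr (Finset.mem_univ _), ?_⟩
    ext y
    simp only [Finset.mem_filter, Finset.mem_univ, true_and]
    exact Finpartition.mem_part_iff_part_eq_part _ (Finset.mem_univ _) (Finset.mem_univ _)
  · rintro ⟨U, hU, rfl⟩
    obtain ⟨k, hk⟩ := ρ.nonempty_of_mem_parts hU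
    refine ⟨pairFst k, Finset.mem_univ _, ?_⟩
    ext y
    simp only [Finset.mem_filter, Finset.mem_univ, true_and, half_pairFst]
    rw [ρ.part_eq_of_mem hU hk, ρ.part_eq_iff_mem hU]

theorem filter_half_injective : Function.Injective
    fun U : Finset (Fin n) => Finset.univ.filter fun x : Fin (2 * n) => half x ∈ U := by
  intro U U' h
  ext k
  have : pairFst k ∈ Finset.univ.filter (fun x : Fin (2 * n) => half x ∈ U) ↔
      pairFst k ∈ Finset.univ.filter (fun x : Fin (2 * n) => half x ∈ U') := by
    simp only at h
    rw [h]
  simpa using this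

theorem doublePartition_parts (ρ : SetPartition n) : (doublePartition ρ).parts =
    ρ.parts.image fun U => Finset.univ.filter fun x => half x ∈ U := by
  ext V
  rw [mem_doublePartition, Finset.mem_image]

theorem mem_doublePartition_iff_of_half_eq {ρ : SetPartition n} {V : Finset (Fin (2 * n))}
    (hV : V ∈ (doublePartition ρ).parts) {x y : Fin (2 * n)} (h : half x = half y) :
    x ∈ V ↔ y ∈ V := by
  obtain ⟨U, -, rfl⟩ := mem_doublePartition.mp hV
  simp [h]

theorem nonCrossing_doublePartition {ρ : SetPartition n} (hρ : NonCrossing ρ) :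
    NonCrossing (doublePartition ρ) := by
  apply nonCrossing_fiberPartition
  intro i _ j _ k _ l _ hij hjk hkl hik hjl
  have hmono : ∀ {x y : Fin (2 * n)}, x < y → half x = half y ∨ half x < half y := by
    intro x y h
    rw [Fin.lt_def] at h
    simp only [Fin.ext_iff, Fin.lt_def, half]
    omega
  have hm := fun x => ρ.mem_part (Finset.mem_univ (half x))
  have hp := fun x => ρ.part_mem.mpr (Finset.mem_univ (half x))
  rcases hmono hij with h1 | h1
  · rw [h1]
  rcases hmono hjk with h2 | h2
  · rw [hik, h2]
  rcases hmono hkl with h3 | h3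
  · rw [hik, hjl, h3]
  · exact hρ _ _ _ _ h1 h2 h3 _ (hp i) _ (hp j) (hm i) (hik ▸ hm k) (hm j) (hjl ▸ hm l)

/-- A test colouring of one doubled block extends by zero to the others, because no block or pair
leaves it. -/
theorem comp_bind_eq_iff {ρ : SetPartition n}
    {Q : ∀ V ∈ (doublePartition ρ).parts, Finpartition V} :
    comp ((doublePartition ρ).bind Q) = ρ ↔ ∀ V hV, PairConnected (Q V hV) := by
  classical
  rw [comp_eq_iff]
  constructor
  · rintro ⟨-, h⟩ V hV c hc hp x hx y hy
    let c' : Fin (2 * n) → ZMod 2 := fun z => if z ∈ V then c z else 0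
    have hc' : ConstOnParts c' ((doublePartition ρ).bind Q) := by
      rw [constOnParts_bind]
      intro W hW U hU z hz t ht
      by_cases hWV : W = V
      · subst hWV
        simp only [c']
        rw [if_pos ((Q W hW).le hU hz), if_pos ((Q W hW).le hU ht)]
        exact hc U hU z hz t ht
      · have hn : ∀ z ∈ W, z ∉ V := fun z hz hz' =>
          hWV ((doublePartition ρ).eq_of_mem_parts hW hV hz hz')
        simp only [c']
        rw [if_neg (hn z ((Q W hW).le hU hz)), if_neg (hn t ((Q W hW).le hU ht))]
    have hp' : PairConst Finset.univ c' := by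
      intro k _
      have hk : pairFst k ∈ V ↔ pairSnd k ∈ V :=
        mem_doublePartition_iff_of_half_eq hV (by simp)
      simp only [c']
      by_cases hkV : pairFst k ∈ V
      · rw [if_pos hkV, if_pos (hk.mp hkV), hp k hkV]
      · rw [if_neg hkV, if_neg (fun h => hkV (hk.mpr h))]
    have hxy : ρ.part (half x) = ρ.part (half y) :=
      constOnParts_fiberPartition Finset.univ (fun x => ρ.part (half x)) V hV x hx y hy
    have := h c' hc' hp' _ _ hxy
    rw [← hp'.eq_half, ← hp'.eq_half] at this
    simp only [c'] at this
    rwa [if_pos hx, if_pos hy] at this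
  · intro h
    refine ⟨bind_le _ _, fun c hc hp k l hkl => ?_⟩
    have hV := (doublePartition ρ).part_mem.mpr (Finset.mem_univ (pairFst k))
    refine h _ hV c (constOnParts_bind.mp hc _ hV) (fun j _ => hp j (Finset.mem_univ _)) _
      ((doublePartition ρ).mem_part (Finset.mem_univ _)) _ ?_
    rw [doublePartition, mem_fiberPartition_part]
    simpa using hkl

/-- Every pair lies inside one doubled block, so colourings of the pieces glue without further
conditions. -/
theorem pairBipartite_bind_iff {ρ : SetPartition n}
    {Q : ∀ V ∈ (doublePartition ρ).parts, Finpartition V} :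
    PairBipartite ((doublePartition ρ).bind Q) ↔ ∀ V hV, PairBipartite (Q V hV) := by
  constructor
  · rintro ⟨c, hc, hp⟩ V hV
    exact ⟨c, constOnParts_bind.mp hc V hV, fun k _ => hp k (Finset.mem_univ _)⟩
  · intro h
    choose c hc hp using h
    have hpart := fun x => (doublePartition ρ).part_mem.mpr (Finset.mem_univ x)
    have hcx : ∀ V hV, ∀ x ∈ V, c _ (hpart x) x = c V hV x := by
      intro V hV x hx
      obtain rfl := (doublePartition ρ).part_eq_of_mem hV hx
      rfl
    refine ⟨fun x => c _ (hpart x) x, ?_, ?_⟩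
    · rw [constOnParts_bind]
      intro V hV U hU x hx y hy
      beta_reduce
      rw [hcx V hV x ((Q V hV).le hU hx), hcx V hV y ((Q V hV).le hU hy)]
      exact hc V hV U hU x hx y hy
    · intro k _
      have h1 := (doublePartition ρ).mem_part (Finset.mem_univ (pairFst k))
      beta_reduce
      rw [hcx _ (hpart (pairFst k)) (pairFst k) h1, hcx _ (hpart (pairFst k)) (pairSnd k)
        ((mem_doublePartition_iff_of_half_eq (hpart _) (by simp)).mp h1)]
      exact hp _ _ k h1

open Classical in
/-- The number of proper colourings is `2` to the number of components, if there are any. -/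
theorem card_proper_colorings (π : SetPartition (2 * n)) :
    (Finset.univ.filter fun c : Fin (2 * n) → ZMod 2 => IsProper c ∧ ConstOnParts c π).card =
      if PairBipartite π then 2 ^ (comp π).parts.card else 0 := by
  split_ifs with hb
  · obtain ⟨c₀, hc₀, hp₀⟩ := hb
    have hcard : Fintype.card ((comp π).parts → ZMod 2) = 2 ^ (comp π).parts.card := by
      rw [Fintype.card_fun, ZMod.card, Fintype.card_coe]
    rw [← hcard, ← Finset.card_univ]
    symm
    let p : Fin (2 * n) → (comp π).parts := fun x =>
      ⟨(comp π).part (half x), (comp π).part_mem.mpr (Finset.mem_univ _)⟩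
    have hp : ∀ V ∈ π.parts, ∀ x ∈ V, ∀ y ∈ V, p x = p y := fun V hV x hx y hy =>
      Subtype.ext (le_doublePartition_iff.mp (le_double_comp π) V hV x hx y hy)
    -- The proper colourings are the translates of `c₀` by functions that are constant on
    -- components.
    refine Finset.card_bij (fun d _ x => c₀ x + d (p x)) ?_ ?_ ?_
    · intro d _
      rw [Finset.mem_filter]
      refine ⟨Finset.mem_univ _, fun k => ?_, fun V hV x hx y hy => ?_⟩
      · have : p (pairSnd k) = p (pairFst k) := Subtype.ext (by simp [p])
        beta_reduce
        rw [hp₀ k (Finset.mem_univ _), this]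
        ring
      · simp only
        rw [hc₀ V hV x hx y hy, hp V hV x hx y hy]
    · intro d _ d' _ hdd
      funext V
      obtain ⟨k, hk⟩ := (comp π).nonempty_of_mem_parts V.2
      have hV : p (pairFst k) = V :=
        Subtype.ext (by simp only [p, half_pairFst]; exact (comp π).part_eq_of_mem V.2 hk)
      have := congrFun hdd (pairFst k)
      simp only [add_right_inj] at this
      rwa [hV] at this
    · intro c hc
      obtain ⟨-, hcp, hcc⟩ := Finset.mem_filter.mp hc
      have hd : ConstOnParts (fun x => c x - c₀ x) π := fun V hV x hx y hy => by
        simp only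
        rw [hcc V hV x hx y hy, hc₀ V hV x hx y hy]
      have hd' : PairConst Finset.univ fun x => c x - c₀ x := fun k hk => by
        simp only
        rw [hcp k, hp₀ k hk]
        ring
      choose e he using fun V : (comp π).parts => (comp π).nonempty_of_mem_parts V.2
      refine ⟨fun V => c (pairFst (e V)) - c₀ (pairFst (e V)), Finset.mem_univ _, ?_⟩
      funext x
      have h1 : (comp π).part (e (p x)) = (comp π).part (half x) :=
        (comp π).part_eq_of_mem (p x).2 (he _)
      have h2 := comp_part_eq_iff.mp h1 _ hd hd'
      beta_reduce at h2 ⊢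
      rw [h2, ← hd'.eq_half x]
      ring
  · rw [Finset.card_eq_zero, Finset.filter_eq_empty_iff]
    rintro c - ⟨h1, h2⟩
    exact hb ⟨c, h2, fun k _ => h1 k⟩

open Classical in
/-- The weight of a partition of a union of pairs in the cumulants of the anti-commutator. -/
noncomputable def pairWeight (r : ℂ) {V : Finset (Fin (2 * n))} (π : Finpartition V) : ℂ :=
  if PairConnected π ∧ PairBipartite π then 2 * r ^ π.parts.card else 0

-- When `comp` equals `ρ`, the colouring count `2 ^ |ρ|` supplies one factor `2` per component, and
-- block counts add up. If some piece is disconnected or not bipartite, both sides vanish.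
open Classical in
theorem weight_bind (r : ℂ) (ρ : SetPartition n)
    (Q : ∀ V ∈ (doublePartition ρ).parts, Finpartition V) :
    (if comp ((doublePartition ρ).bind Q) = ρ then
      r ^ ((doublePartition ρ).bind Q).parts.card *
        ((Finset.univ.filter fun c : Fin (2 * n) → ZMod 2 =>
          IsProper c ∧ ConstOnParts c ((doublePartition ρ).bind Q)).card : ℂ) else 0) =
      ∏ V ∈ (doublePartition ρ).parts.attach, pairWeight r (Q V.1 V.2) := by
  by_cases h : ∀ V hV, PairConnected (Q V hV) ∧ PairBipartite (Q V hV)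
  · have hcomp := comp_bind_eq_iff.mpr fun V hV => (h V hV).1
    have hcard : (doublePartition ρ).parts.card = ρ.parts.card := by
      rw [doublePartition_parts, Finset.card_image_of_injective _ filter_half_injective]
    rw [if_pos hcomp, card_proper_colorings, if_pos (pairBipartite_bind_iff.mpr fun V hV =>
      (h V hV).2), hcomp, Finpartition.card_bind]
    simp only [pairWeight]
    rw [Finset.prod_congr rfl fun V _ => if_pos (h V.1 V.2), Finset.prod_mul_distrib,
      Finset.prod_const, Finset.card_attach, hcard, ← Finset.prod_pow_eq_pow_sum, mul_comm]
    push_cast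
    rfl
  · have hz : ∏ V ∈ (doublePartition ρ).parts.attach, pairWeight r (Q V.1 V.2) = 0 := by
      push Not at h
      obtain ⟨V, hV, h⟩ := h
      exact Finset.prod_eq_zero (Finset.mem_attach _ ⟨V, hV⟩) (if_neg fun h' => h h'.1 h'.2)
    rw [hz]
    split_ifs with hcomp
    · rw [card_proper_colorings, if_neg, Nat.cast_zero, mul_zero]
      rw [comp_bind_eq_iff] at hcomp
      rw [pairBipartite_bind_iff]
      exact fun hb => h fun V hV => ⟨hcomp V hV, hb V hV⟩
    · rfl

/-- The order embedding of `[2k]` into `[2n]` that maps the `j`-th pair to the `e j`-th pair. -/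
def pairEmb {k : ℕ} (e : Fin k ↪o Fin n) : Fin (2 * k) ↪o Fin (2 * n) :=
  OrderEmbedding.ofStrictMono (fun x => ⟨2 * (e (half x)).val + x.val % 2, by omega⟩) <| by
    intro x y hxy
    rw [Fin.lt_def] at hxy ⊢
    simp only
    by_cases h : half x = half y
    · rw [h]
      simp only [Fin.ext_iff, half] at h
      omega
    · have h1 : half x < half y := by
        simp only [Fin.ext_iff, half] at h
        simp only [Fin.lt_def, half]
        omega
      have h2 : e (half x) < e (half y) := e.strictMono h1
      rw [Fin.lt_def] at h2
      omega

theorem pairEmb_pairFst {k : ℕ} (e : Fin k ↪o Fin n) (j : Fin k) :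
    pairEmb e (pairFst j) = pairFst (e j) := by
  have : (pairEmb e (pairFst j)).val = 2 * (e (half (pairFst j))).val + (2 * j.val) % 2 := rfl
  ext
  rw [this, half_pairFst]
  simp [pairFst]

theorem pairEmb_pairSnd {k : ℕ} (e : Fin k ↪o Fin n) (j : Fin k) :
    pairEmb e (pairSnd j) = pairSnd (e j) := by
  have : (pairEmb e (pairSnd j)).val = 2 * (e (half (pairSnd j))).val + (2 * j.val + 1) % 2 := rfl
  ext
  rw [this, half_pairSnd]
  simp [pairSnd]

theorem map_pairEmb (U : Finset (Fin n)) {k : ℕ} (h : U.card = k) :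
    Finset.univ.map (pairEmb (U.orderEmbOfFin h)).toEmbedding =
      Finset.univ.filter fun x => half x ∈ U := by
  ext x
  simp only [Finset.mem_map, Finset.mem_univ, true_and, Finset.mem_filter,
    RelEmbedding.coe_toEmbedding]
  constructor
  · rintro ⟨y, rfl⟩
    rcases eq_pairFst_or_eq_pairSnd y with hy | hy
    · rw [hy, pairEmb_pairFst, half_pairFst]
      exact Finset.orderEmbOfFin_mem U h _
    · rw [hy, pairEmb_pairSnd, half_pairSnd]
      exact Finset.orderEmbOfFin_mem U h _
  · intro hx
    have : half x ∈ Set.range (U.orderEmbOfFin h) := by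
      rw [Finset.range_orderEmbOfFin]
      exact hx
    obtain ⟨j, hj⟩ := this
    rcases eq_pairFst_or_eq_pairSnd x with hy | hy
    · exact ⟨pairFst j, by rw [pairEmb_pairFst, hj, ← hy]⟩
    · exact ⟨pairSnd j, by rw [pairEmb_pairSnd, hj, ← hy]⟩

/-- Only the relative order of the pairs matters, so a doubled block contributes a quantity
depending only on its number of pairs. Colourings are moved by composition with the embedding and by
extension by zero. -/
theorem pairWeight_transport (r : ℂ) (U : Finset (Fin n)) {k : ℕ} (h : U.card = k)
    (π : SetPartition (2 * k)) :
    pairWeight r ((mapEmb (pairEmb (U.orderEmbOfFin h)) π).copy (map_pairEmb U h)) =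
      pairWeight r π := by
  classical
  set e := pairEmb (U.orderEmbOfFin h) with he
  have hconst : ∀ c : Fin (2 * n) → ZMod 2,
      ConstOnParts c ((mapEmb e π).copy (map_pairEmb U h)) ↔ ConstOnParts (c ∘ e) π :=
    fun c => constOnParts_mapEmb
  have hcard : ((mapEmb e π).copy (map_pairEmb U h)).parts.card = π.parts.card := card_mapEmb e π
  have hmem : ∀ {l : Fin n}, pairFst l ∈ Finset.univ.filter (fun x : Fin (2 * n) => half x ∈ U) →
      ∃ j, U.orderEmbOfFin h j = l := by
    intro l hl
    simp only [Finset.mem_filter, Finset.mem_univ, true_and, half_pairFst] at hl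
    have : l ∈ Set.range (U.orderEmbOfFin h) := by
      rw [Finset.range_orderEmbOfFin]
      exact hl
    exact this
  have hmem' : ∀ x, e x ∈ Finset.univ.filter (fun x : Fin (2 * n) => half x ∈ U) := by
    intro x
    rw [← map_pairEmb U h]
    exact Finset.mem_map_of_mem _ (Finset.mem_univ x)
  have hext : ∀ c : Fin (2 * k) → ZMod 2, Function.extend e c 0 ∘ e = c := fun c =>
    Function.extend_comp e.injective c 0
  have hext' : ∀ (c : Fin (2 * k) → ZMod 2) x, Function.extend e c 0 (e x) = c x := fun c x =>
    e.injective.extend_apply c 0 x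
  have hconn : PairConnected ((mapEmb e π).copy (map_pairEmb U h)) ↔ PairConnected π := by
    constructor
    · intro hC c hc hp x _ y _
      have := hC (Function.extend e c 0) ((hconst _).mpr (by rwa [hext])) ?_ (e x) (hmem' x)
        (e y) (hmem' y)
      · rwa [hext', hext'] at this
      · intro l hl
        obtain ⟨j, rfl⟩ := hmem hl
        rw [← pairEmb_pairFst, ← pairEmb_pairSnd, ← he, hext', hext']
        exact hp j (Finset.mem_univ _)
    · intro hC c hc hp x hx y hy
      rw [← map_pairEmb U h] at hx hy
      obtain ⟨x, -, rfl⟩ := Finset.mem_map.mp hx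
      obtain ⟨y, -, rfl⟩ := Finset.mem_map.mp hy
      refine hC (c ∘ e) ((hconst c).mp hc) (fun j _ => ?_) x (Finset.mem_univ _) y
        (Finset.mem_univ _)
      simp only [Function.comp_apply]
      have := hp (U.orderEmbOfFin h j) (by rw [← pairEmb_pairFst]; exact hmem' _)
      rwa [← pairEmb_pairFst, ← pairEmb_pairSnd] at this
  have hbip : PairBipartite ((mapEmb e π).copy (map_pairEmb U h)) ↔ PairBipartite π := by
    constructor
    · rintro ⟨c, hc, hp⟩
      refine ⟨c ∘ e, (hconst c).mp hc, fun j _ => ?_⟩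
      have := hp (U.orderEmbOfFin h j) (by rw [← pairEmb_pairFst]; exact hmem' _)
      rwa [← pairEmb_pairFst, ← pairEmb_pairSnd] at this
    · rintro ⟨c, hc, hp⟩
      refine ⟨Function.extend e c 0, (hconst _).mpr (by rwa [hext]), fun l hl => ?_⟩
      obtain ⟨j, rfl⟩ := hmem hl
      rw [← pairEmb_pairFst, ← pairEmb_pairSnd, ← he, hext', hext']
      exact hp j (Finset.mem_univ _)
  exact if_congr (and_congr hconn hbip) (by rw [hcard]) rfl

/-- The sum of the weights of all non-crossing partitions of `[2k]`. -/
noncomputable def pairCumulant (r : ℂ) (k : ℕ) : ℂ :=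
  ∑ π ∈ NC (2 * k), pairWeight r π

open Classical in
/-- The moments of the anti-commutator as a sum over the possible partitions into components. -/
theorem sum_colorings_eq (r : ℂ) (n : ℕ) :
    ∑ π ∈ NC (2 * n), r ^ π.parts.card *
      ((Finset.univ.filter fun c : Fin (2 * n) → ZMod 2 =>
        IsProper c ∧ ConstOnParts c π).card : ℂ) =
      ∑ ρ ∈ NC n, ∏ U ∈ ρ.parts, pairCumulant r U.card := by
  simp only [NC_eq_ncParts]
  rw [← Finset.sum_fiberwise_of_maps_to (g := comp) (t := ncParts Finset.univ)
    fun π hπ => mem_ncParts.mpr (nonCrossing_comp (mem_ncParts.mp hπ))]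
  refine Finset.sum_congr rfl fun ρ hρ => ?_
  have hρ := nonCrossing_doublePartition (mem_ncParts.mp hρ)
  have h := sum_ncParts_le_eq_prod hρ (fun π => if comp π = ρ then r ^ π.parts.card *
      ((Finset.univ.filter fun c : Fin (2 * n) → ZMod 2 =>
        IsProper c ∧ ConstOnParts c π).card : ℂ) else 0) (fun V π => pairWeight r π)
      (weight_bind r ρ)
  rw [Finset.sum_filter] at h ⊢
  -- A partition with component partition `ρ` lies below the doubled `ρ`, so restricting the sum to
  -- that interval loses nothing.
  have h' : ∀ π ∈ ncParts (Finset.univ : Finset (Fin (2 * n))), (if comp π = ρ then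
      r ^ π.parts.card * ((Finset.univ.filter fun c : Fin (2 * n) → ZMod 2 =>
        IsProper c ∧ ConstOnParts c π).card : ℂ) else 0) =
      if π ≤ doublePartition ρ then (if comp π = ρ then r ^ π.parts.card *
      ((Finset.univ.filter fun c : Fin (2 * n) → ZMod 2 =>
        IsProper c ∧ ConstOnParts c π).card : ℂ) else 0) else 0 := by
    intro π _
    by_cases hc : comp π = ρ
    · rw [if_pos hc, if_pos (comp_eq_iff.mp hc).1]
    · rw [if_neg hc, ite_self]
  rw [Finset.sum_congr rfl h', h, doublePartition_parts,
    Finset.prod_image (filter_half_injective.injOn)]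
  refine Finset.prod_congr rfl fun U _ => ?_
  rw [pairCumulant, NC_eq_ncParts]
  exact sum_ncParts_eq_of_map_eq _ (map_pairEmb U rfl) _ _ fun π => pairWeight_transport r U rfl π

end Components

/-! ### The graph of a partition -/

section Graphs

variable {n : ℕ} {π : SetPartition (2 * n)}

theorem partitionGraph_adj_iff {V W : Finset (Fin (2 * n))} : (partitionGraph π).Adj V W ↔
    ∃ k : Fin n, s(V, W) = s(π.part (pairFst k), π.part (pairSnd k)) := Iff.rfl

/-- Colourings constant on blocks and pairs do not change along edges; conversely, the indicator of
reachability from `u` is such a colouring. The bound `1 ≤ n` provides the vertex that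
`GraphConnected` demands. -/
theorem graphConnected_iff (hn : 1 ≤ n) :
    GraphConnected (partitionGraph π) ↔ PairConnected π := by
  classical
  constructor
  · rintro ⟨-, h⟩ c hc hp x _ y _
    have hx := π.part_mem.mpr (Finset.mem_univ x)
    have hpath := h (π.part x) hx (π.part y) (π.part_mem.mpr (Finset.mem_univ y))
    have hpart : ∀ u v, v ∈ π.part u → c v = c u := fun u v hv =>
      hc _ (π.part_mem.mpr (Finset.mem_univ u)) v hv u (π.mem_part (Finset.mem_univ u))
    have key : ∀ W, Relation.ReflTransGen (partitionGraph π).Adj (π.part x) W →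
        ∀ z ∈ W, c z = c x := by
      intro W hW
      induction hW with
      | refl => exact fun z hz => hpart x z hz
      | @tail V W _ hVW ih =>
        obtain ⟨k, hk⟩ := partitionGraph_adj_iff.mp hVW
        have hpk := hp k (Finset.mem_univ _)
        have h1 := π.mem_part (Finset.mem_univ (pairFst k))
        have h2 := π.mem_part (Finset.mem_univ (pairSnd k))
        intro z hz
        rcases Sym2.eq_iff.mp hk with ⟨rfl, rfl⟩ | ⟨rfl, rfl⟩
        · rw [hpart _ z hz, hpk, ih _ h1]
        · rw [hpart _ z hz, ← hpk, ih _ h2]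
    exact (key _ hpath y (π.mem_part (Finset.mem_univ y))).symm
  · intro h
    refine ⟨⟨π.part ⟨0, by omega⟩, π.part_mem.mpr (Finset.mem_univ _)⟩, fun u hu v hv => ?_⟩
    obtain ⟨x, hx⟩ := π.nonempty_of_mem_parts hu
    obtain ⟨y, hy⟩ := π.nonempty_of_mem_parts hv
    have := h (fun z => if Relation.ReflTransGen (partitionGraph π).Adj u (π.part z) then 1 else 0)
      ?_ ?_ x (Finset.mem_univ _) y (Finset.mem_univ _)
    · rw [π.part_eq_of_mem hu hx, π.part_eq_of_mem hv hy, if_pos Relation.ReflTransGen.refl] at this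
      by_contra hne
      rw [if_neg hne] at this
      exact one_ne_zero this
    · intro V hV z hz t ht
      simp only
      rw [π.part_eq_of_mem hV hz, π.part_eq_of_mem hV ht]
    · intro k _
      have h1 : (partitionGraph π).Adj (π.part (pairFst k)) (π.part (pairSnd k)) := ⟨k, rfl⟩
      have h2 : (partitionGraph π).Adj (π.part (pairSnd k)) (π.part (pairFst k)) :=
        ⟨k, Sym2.eq_swap⟩
      simp only
      congr 1
      exact propext ⟨fun h => h.tail h2, fun h => h.tail h1⟩

theorem graphBipartite_iff : GraphBipartite (partitionGraph π) ↔ PairBipartite π := by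
  classical
  constructor
  · rintro ⟨P, Q, -, hdisj, hadj⟩
    refine ⟨fun x => if π.part x ∈ P then 0 else 1, fun V hV x hx y hy => ?_, fun k _ => ?_⟩
    · simp only
      rw [π.part_eq_of_mem hV hx, π.part_eq_of_mem hV hy]
    · have h2 : (1 : ZMod 2) + 1 = 0 := rfl
      rcases hadj (π.part (pairFst k)) (π.part (pairSnd k)) ⟨k, rfl⟩ with h | h
      · simp only
        rw [if_pos h.1, if_neg fun h' => Set.disjoint_left.mp hdisj h' h.2, zero_add]
      · simp only
        rw [if_pos h.2, if_neg fun h' => Set.disjoint_left.mp hdisj h' h.1, h2]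
  · rintro ⟨c, hc, hp⟩
    have h01 : ∀ z : ZMod 2, z = 0 ∨ z = 1 := by decide
    refine ⟨{V | V ∈ π.parts ∧ ∃ x ∈ V, c x = 0}, {V | V ∈ π.parts ∧ ∃ x ∈ V, c x = 1},
      ?_, ?_, ?_⟩
    · ext V
      constructor
      · rintro (h | h) <;> exact h.1
      · intro hV
        obtain ⟨x, hx⟩ := π.nonempty_of_mem_parts hV
        rcases h01 (c x) with h | h
        · exact Or.inl ⟨hV, x, hx, h⟩
        · exact Or.inr ⟨hV, x, hx, h⟩
    · rw [Set.disjoint_left]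
      rintro V ⟨hV, x, hx, h0⟩ ⟨-, y, hy, h1⟩
      rw [hc V hV x hx y hy, h1] at h0
      exact one_ne_zero h0
    · have key : ∀ x y : Fin (2 * n), c x = c y + 1 →
          (c x = 0 ∧ c y = 1) ∨ (c x = 1 ∧ c y = 0) := by
        intro x y h
        generalize c x = s at h
        generalize c y = t at h
        revert s t
        decide
      intro V W hVW
      obtain ⟨k, hk⟩ := partitionGraph_adj_iff.mp hVW
      have hm := fun x => π.mem_part (Finset.mem_univ x)
      have hpt := fun x => π.part_mem.mpr (Finset.mem_univ x)
      rcases Sym2.eq_iff.mp hk with ⟨rfl, rfl⟩ | ⟨rfl, rfl⟩ <;>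
      rcases key _ _ (hp k (Finset.mem_univ _)) with ⟨h1, h2⟩ | ⟨h1, h2⟩
      · exact Or.inr ⟨⟨hpt _, _, hm _, h2⟩, hpt _, _, hm _, h1⟩
      · exact Or.inl ⟨⟨hpt _, _, hm _, h2⟩, hpt _, _, hm _, h1⟩
      · exact Or.inl ⟨⟨hpt _, _, hm _, h1⟩, hpt _, _, hm _, h2⟩
      · exact Or.inr ⟨⟨hpt _, _, hm _, h1⟩, hpt _, _, hm _, h2⟩

theorem mem_ncX (hn : 1 ≤ n) :
    π ∈ ncX n ↔ NonCrossing π ∧ PairConnected π ∧ PairBipartite π := by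
  simp only [ncX, Finset.mem_filter, NC_eq_ncParts, mem_ncParts, graphConnected_iff hn,
    graphBipartite_iff]

theorem pairCumulant_eq (r : ℂ) (hn : 1 ≤ n) :
    pairCumulant r n = 2 * ∑ π ∈ ncX n, r ^ π.parts.card := by
  classical
  have h : ncX n = (NC (2 * n)).filter fun π => PairConnected π ∧ PairBipartite π := by
    ext π
    rw [mem_ncX hn, Finset.mem_filter, NC_eq_ncParts, mem_ncParts]
  rw [h, Finset.sum_filter, Finset.mul_sum, pairCumulant]
  refine Finset.sum_congr rfl fun π _ => ?_
  rw [pairWeight, mul_ite, mul_zero]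

variable {A : Type*} [Ring A] [Algebra ℂ A]

/-- The cumulants of the anti-commutator of two free elements with free Poisson distribution. -/
theorem cumulant_anticommutator {φ : A →ₗ[ℂ] ℂ} (hφ : φ 1 = 1) {a b : A} (hab : Free φ a b) {r : ℂ}
    (ha : IsFreePoisson φ r a) (hb : IsFreePoisson φ r b) (hn : 1 ≤ n) :
    cumulant φ n (a * b + b * a) = 2 * ∑ π ∈ ncX n, r ^ π.parts.card := by
  rw [← pairCumulant_eq r hn]
  refine cumulant_unique φ _ (pairCumulant r) (fun m _ => ?_) hn
  rw [moment_anticommutator hφ hab ha hb, sum_colorings_eq]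

end Graphs

/-! ### The Kreweras complement -/

section Kreweras

variable {m : ℕ}

/-- The indicator function of `x < i` modulo two. -/
def below (i x : Fin m) : ZMod 2 := if x < i then 1 else 0

theorem zmod_two_add_self (a : ZMod 2) : a + a = 0 := CharTwo.add_self_eq_zero a

theorem zmod_two_eq_of_add_eq_zero {a b : ZMod 2} (h : a + b = 0) : a = b :=
  CharTwo.add_eq_zero.mp h

/-- Two elements are equivalent if the interval between them is a union of blocks of `π`. -/
def krewerasSetoid (π : SetPartition m) : Setoid (Fin m) where
  -- The sum of the two indicators is, modulo two, the indicator of the half-open interval between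
  -- `i` and `j`, whichever is smaller. Thus `i` stands for the gap just before `i`.
  r i j := ConstOnParts (fun x => below i x + below j x) π
  iseqv := by
    refine ⟨fun i V _ x _ y _ => ?_, fun {i j} h V hV x hx y hy => ?_,
      fun {i j k} h h' V hV x hx y hy => ?_⟩
    · simp only [zmod_two_add_self]
    · have := h V hV x hx y hy
      simp only at this ⊢
      rw [add_comm (below j x), this, add_comm]
    · have h1 := h V hV x hx y hy
      have h2 := h' V hV x hx y hy
      simp only at h1 h2 ⊢
      have e : ∀ z, below i z + below k z = (below i z + below j z) + (below j z + below k z) := by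
        intro z
        linear_combination (-1 : ZMod 2) * zmod_two_add_self (below j z)
      rw [e, e, h1, h2]

open Classical in
/-- The Kreweras complement of a partition: `i` and `j` are in the same block if the interval
between them is a union of blocks of `π`. -/
noncomputable def kreweras (π : SetPartition m) : SetPartition m :=
  Finpartition.ofSetoid (krewerasSetoid π)

theorem kreweras_part_eq_iff {π : SetPartition m} {i j : Fin m} :
    (kreweras π).part i = (kreweras π).part j ↔
      ConstOnParts (fun x => below i x + below j x) π := by
  classical
  rw [← Finpartition.mem_part_iff_part_eq_part _ (Finset.mem_univ _) (Finset.mem_univ _), kreweras,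
    Finpartition.mem_part_ofSetoid_iff_rel]
  exact ⟨fun h => (krewerasSetoid π).symm h, fun h => (krewerasSetoid π).symm h⟩

theorem kreweras_rel {π : SetPartition m} {W : Finset (Fin m)} (hW : W ∈ (kreweras π).parts)
    {i j : Fin m} (hi : i ∈ W) (hj : j ∈ W) :
    ConstOnParts (fun x => below i x + below j x) π := by
  rw [← kreweras_part_eq_iff, (kreweras π).part_eq_of_mem hW hi, (kreweras π).part_eq_of_mem hW hj]

theorem constOnParts_of_interval {π : SetPartition m} {g : Fin m → ZMod 2} {P : Fin m → Prop}
    (a : ZMod 2) (hg : ∀ x, P x → g x = a) (hg' : ∀ x, ¬ P x → g x = a + 1)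
    (hP : ∀ V ∈ π.parts, ∀ x ∈ V, ∀ y ∈ V, P x → P y) : ConstOnParts g π := by
  intro V hV x hx y hy
  by_cases h : P x
  · rw [hg x h, hg y (hP V hV x hx y hy h)]
  · rw [hg' x h, hg' y fun h' => h (hP V hV y hy x hx h')]

theorem below_add_below_of_le {i j : Fin m} (hij : i ≤ j) (x : Fin m) :
    below i x + below j x = if i ≤ x ∧ x < j then 1 else 0 := by
  simp only [below]
  by_cases h1 : x < i
  · rw [if_pos h1, if_pos (lt_of_lt_of_le h1 hij), if_neg fun h => absurd h.1 (not_le.mpr h1)]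
    rfl
  · by_cases h2 : x < j
    · rw [if_neg h1, if_pos h2, if_pos ⟨not_lt.mp h1, h2⟩, zero_add]
    · rw [if_neg h1, if_neg h2, if_neg fun h => h2 h.2, zero_add]

theorem interval_of_rel {π : SetPartition m} {i j : Fin m} (hij : i ≤ j)
    (h : ConstOnParts (fun x => below i x + below j x) π) {V : Finset (Fin m)} (hV : V ∈ π.parts)
    {x y : Fin m} (hx : x ∈ V) (hy : y ∈ V) (hxi : i ≤ x ∧ x < j) : i ≤ y ∧ y < j := by
  have := h V hV x hx y hy
  simp only [below_add_below_of_le hij] at this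
  rw [if_pos hxi] at this
  by_contra hne
  rw [if_neg hne] at this
  exact one_ne_zero this

theorem rel_of_interval {π : SetPartition m} {i j : Fin m} (hij : i ≤ j)
    (h : ∀ V ∈ π.parts, ∀ x ∈ V, ∀ y ∈ V, (i ≤ x ∧ x < j) → (i ≤ y ∧ y < j)) :
    ConstOnParts (fun x => below i x + below j x) π := by
  refine constOnParts_of_interval 1 (fun x hx => ?_) (fun x hx => ?_) h
  · simp only [below_add_below_of_le hij]
    rw [if_pos hx]
  · simp only [below_add_below_of_le hij]
    rw [if_neg hx]
    rfl

/-- The interval from `j` to `k` is the intersection of those from `i` to `k` and from `j` to `l`,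
and an intersection of unions of blocks is a union of blocks. -/
theorem nonCrossing_kreweras (π : SetPartition m) : NonCrossing (kreweras π) := by
  intro i j k l hij hjk hkl V hV W hW hi hk hj hl
  have h1 := kreweras_rel hV hi hk
  have h2 := kreweras_rel hW hj hl
  have h3 : ConstOnParts (fun x => below j x + below k x) π := by
    refine rel_of_interval hjk.le fun U hU x hx y hy hxj => ?_
    have hy1 := interval_of_rel (hij.trans hjk).le h1 hU hx hy ⟨hij.le.trans hxj.1, hxj.2⟩
    have hy2 := interval_of_rel (hjk.trans hkl).le h2 hU hx hy ⟨hxj.1, hxj.2.trans hkl⟩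
    exact ⟨hy2.1, hy1.2⟩
  rw [← kreweras_part_eq_iff, (kreweras π).part_eq_of_mem hV hk,
    (kreweras π).part_eq_of_mem hW hj] at h3
  exact h3.symm

/-! ### Duality modulo two between colourings and their cyclic differences -/

/-- The cyclic differences of a colouring. -/
def cyclicDiff (c : Fin m → ZMod 2) (i : Fin m) : ZMod 2 := c i + c ((finRotate m).symm i)

/-- A colouring with prescribed differences whose sums over the blocks of the Kreweras complement
vanish is constant on blocks. -/
theorem constOnParts_sum_below {π : SetPartition m} {d : Fin m → ZMod 2}
    (hd : ∀ W ∈ (kreweras π).parts, ∑ i ∈ W, d i = 0) :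
    ConstOnParts (fun x => ∑ i, d i * below i x) π := by
  intro V hV x hx y hy
  apply zmod_two_eq_of_add_eq_zero
  simp only
  rw [← Finset.sum_add_distrib, ← (kreweras π).biUnion_parts,
    Finset.sum_biUnion (kreweras π).disjoint]
  refine Finset.sum_eq_zero fun W hW => ?_
  obtain ⟨i₀, hi₀⟩ := (kreweras π).nonempty_of_mem_parts hW
  -- For `x`, `y` in one block of `π`, `below i x + below i y` does not depend on `i ∈ W`, so `W`
  -- contributes a multiple of `∑ i ∈ W, d i`.
  have h : ∀ i ∈ W, d i * below i x + d i * below i y =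
      d i * (below i₀ x + below i₀ y) := by
    intro i hi
    have := kreweras_rel hW hi hi₀ V hV x hx y hy
    simp only at this
    rw [← mul_add]
    congr 1
    linear_combination this - zmod_two_add_self (below i₀ x) + zmod_two_add_self (below i y)
  simp only [id]
  rw [Finset.sum_congr rfl h, ← Finset.sum_mul, hd W hW, zero_mul]

theorem finRotate_val_of_lt {i : Fin m} (h : i.val + 1 < m) : (finRotate m i).val = i.val + 1 := by
  obtain ⟨k, rfl⟩ : ∃ k, m = k + 1 := ⟨m - 1, by omega⟩
  apply coe_finRotate_of_ne_last
  intro h'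
  rw [h', Fin.val_last] at h
  omega

theorem finRotate_val_of_eq {i : Fin m} (h : i.val + 1 = m) : (finRotate m i).val = 0 := by
  obtain ⟨k, rfl⟩ : ∃ k, m = k + 1 := ⟨m - 1, by omega⟩
  have : i = Fin.last k := Fin.ext (by rw [Fin.val_last]; omega)
  rw [this, finRotate_last]
  rfl

/-- The gaps before and after `i` enclose only `i`. For the last `i` the rotation wraps to `0` and
the complement is enclosed, whence the extra constant. -/
theorem below_add_below_rotate (i x : Fin m) : below i x + below (finRotate m i) x =
    (if x = i then 1 else 0) + (if i.val + 1 = m then 1 else 0) := by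
  rcases Nat.lt_or_ge (i.val + 1) m with h | h
  · have hr := finRotate_val_of_lt h
    rw [if_neg (ne_of_lt h), add_zero, below_add_below_of_le (by rw [Fin.le_def]; omega)]
    congr 1
    rw [eq_iff_iff, Fin.ext_iff, Fin.le_def, Fin.lt_def]
    omega
  · have h : i.val + 1 = m := by omega
    have hr := finRotate_val_of_eq h
    rw [if_pos h]
    simp only [below, Fin.lt_def, hr, Fin.ext_iff, Nat.not_lt_zero, if_false, add_zero]
    by_cases hx : x.val = i.val
    · rw [if_pos hx, if_neg (by omega)]
      rfl
    · rw [if_neg hx, if_pos (by omega), zero_add]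

/-- Summation by parts: a colouring is recovered from its cyclic differences up to its value at the
last point. -/
theorem sum_cyclicDiff_mul_below (c : Fin m → ZMod 2) (x : Fin m) :
    ∑ i, cyclicDiff c i * below i x = c x + ∑ i : Fin m, c i * if i.val + 1 = m then 1 else 0 := by
  have h1 : ∑ i, c ((finRotate m).symm i) * below i x = ∑ i, c i * below (finRotate m i) x := by
    rw [← Equiv.sum_comp (finRotate m)]
    simp only [Equiv.symm_apply_apply]
  simp only [cyclicDiff, add_mul, Finset.sum_add_distrib]
  rw [h1, ← Finset.sum_add_distrib]
  simp only [← mul_add, below_add_below_rotate]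
  simp only [mul_add, Finset.sum_add_distrib]
  rw [add_left_inj]
  simp

/-- Between cyclically consecutive elements of `V`, the gap after one and the gap before the next
are equivalent, because by non-crossing no block lies partly between them. -/
theorem NonCrossing.rel_next {π : SetPartition m} (hπ : NonCrossing π) {V : Finset (Fin m)}
    (hV : V ∈ π.parts) (j : Fin V.card) :
    (kreweras π).part (V.orderEmbOfFin rfl (finRotate _ j)) =
      (kreweras π).part (finRotate m (V.orderEmbOfFin rfl j)) := by
  rw [eq_comm, kreweras_part_eq_iff]
  set e := V.orderEmbOfFin rfl with he
  have hmem : ∀ j, e j ∈ V := Finset.orderEmbOfFin_mem V rfl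
  have hsurj : ∀ x ∈ V, ∃ j, e j = x := by
    intro x hx
    have : x ∈ Set.range e := by
      rw [he, Finset.range_orderEmbOfFin]
      exact hx
    exact this
  have hne : ∀ U ∈ π.parts, ∀ x ∈ U, x ∉ V → ∀ y ∈ U, y ∉ V := by
    intro U hU x hx hxV y hy hyV
    exact hxV (π.eq_of_mem_parts hU hV hy hyV ▸ hx)
  rcases Nat.lt_or_ge (j.val + 1) V.card with h | h
  · have hr := finRotate_val_of_lt h
    have hlt : e j < e (finRotate _ j) := e.strictMono (by rw [Fin.lt_def]; omega)
    set u := e j with hu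
    set v := e (finRotate _ j) with hv
    have hgap : ∀ x, u < x → x < v → x ∉ V := by
      intro x hux hxv hx
      obtain ⟨t, rfl⟩ := hsurj x hx
      have h1 := e.lt_iff_lt.mp hux
      have h2 := e.lt_iff_lt.mp hxv
      rw [Fin.lt_def] at h1 h2
      omega
    have hru : (finRotate m u).val = u.val + 1 :=
      finRotate_val_of_lt (by have := v.isLt; rw [Fin.lt_def] at hlt; omega)
    rw [Fin.lt_def] at hlt
    refine rel_of_interval (by rw [Fin.le_def]; omega) fun U hU x hx y hy hxi => ?_
    rw [Fin.le_def, hru] at hxi ⊢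
    have hux : u < x := by rw [Fin.lt_def]; omega
    have hxV := hgap x hux hxi.2
    have hyV := hne U hU x hx hxV y hy
    have hUV : U ≠ V := fun h => hxV (h ▸ hx)
    have hyu : y ≠ u := fun h => hyV (h ▸ hmem j)
    have hyv : y ≠ v := fun h => hyV (h ▸ hmem _)
    constructor
    · by_contra hc
      have : y < u := lt_of_le_of_ne (by rw [Fin.le_def]; omega) hyu
      exact hUV (hπ y u x v this hux hxi.2 U hU V hV hy hx (hmem j) (hmem _))
    · by_contra hc
      have : v < y := lt_of_le_of_ne (not_lt.mp hc) hyv.symm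
      exact hUV (hπ u x v y hux hxi.2 this V hV U hU (hmem j) (hmem _) hx hy).symm
  -- Here `u` is the maximum and `v` the minimum of `V`; the interval from `v` to `u` is the union
  -- of blocks.
  · have h : j.val + 1 = V.card := by omega
    have hr := finRotate_val_of_eq h
    set u := e j with hu
    set v := e (finRotate _ j) with hv
    have hrange : ∀ x ∈ V, v ≤ x ∧ x ≤ u := by
      intro x hx
      obtain ⟨t, rfl⟩ := hsurj x hx
      refine ⟨e.le_iff_le.mpr ?_, e.le_iff_le.mpr ?_⟩
      · rw [Fin.le_def]
        omega
      · rw [Fin.le_def]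
        omega
    have hvu : v ≤ u := (hrange v (hmem _)).2
    have key : ∀ U ∈ π.parts, ∀ x ∈ U, ∀ y ∈ U, (v ≤ x ∧ x ≤ u) → (v ≤ y ∧ y ≤ u) := by
      intro U hU x hx y hy hxi
      by_cases hxV : x ∈ V
      · obtain rfl := π.eq_of_mem_parts hU hV hx hxV
        exact hrange y hy
      · have hUV : U ≠ V := fun h => hxV (h ▸ hx)
        have hvx : v < x := lt_of_le_of_ne hxi.1 fun h => hxV (h ▸ hmem _)
        have hxu : x < u := lt_of_le_of_ne hxi.2 fun h => hxV (h ▸ hmem _)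
        constructor
        · by_contra hc
          exact hUV (hπ y v x u (not_le.mp hc) hvx hxu U hU V hV hy hx (hmem _) (hmem _))
        · by_contra hc
          exact hUV (hπ v x u y hvx hxu (not_le.mp hc) V hV U hU (hmem _) (hmem _) hx hy).symm
    rcases Nat.lt_or_ge (u.val + 1) m with h' | h'
    · have hru := finRotate_val_of_lt h'
      refine constOnParts_of_interval (P := fun x => v ≤ x ∧ x ≤ u) 1 (fun x hx => ?_)
        (fun x hx => ?_) key
      all_goals
        rw [add_comm, below_add_below_of_le (by rw [Fin.le_def] at hvu ⊢; omega)]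
      · rw [if_pos ⟨hx.1, by rw [Fin.lt_def, hru]; have := hx.2; rw [Fin.le_def] at this; omega⟩]
      · rw [if_neg]
        · rfl
        · rintro ⟨h1, h2⟩
          rw [Fin.lt_def, hru] at h2
          exact hx ⟨h1, by rw [Fin.le_def]; omega⟩
    -- The gap after `u` wraps to `0`, so the relation concerns the complement, the points before
    -- `v`.
    · have hul : u.val + 1 = m := by have := u.isLt; omega
      have hru := finRotate_val_of_eq hul
      have hz : ∀ x, below (finRotate m u) x = 0 := fun x =>
        if_neg (by rw [Fin.lt_def, hru]; omega)
      refine constOnParts_of_interval (P := fun x => v ≤ x ∧ x ≤ u) 0 (fun x hx => ?_)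
        (fun x hx => ?_) key
      all_goals
        rw [hz, zero_add, below]
      · rw [if_neg (not_lt.mpr hx.1)]
      · rw [if_pos, zero_add]
        by_contra hc
        exact hx ⟨not_lt.mp hc, by rw [Fin.le_def]; have := x.isLt; omega⟩

/-- The differences of a colouring that is constant on the blocks of a non-crossing partition sum
to zero over the blocks of the Kreweras complement. -/
theorem sum_cyclicDiff_eq_zero {π : SetPartition m} (hπ : NonCrossing π) {c : Fin m → ZMod 2}
    (hc : ConstOnParts c π) {W : Finset (Fin m)} (hW : W ∈ (kreweras π).parts) :
    ∑ i ∈ W, cyclicDiff c i = 0 := by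
  classical
  let χ : Fin m → ZMod 2 := fun i => if i ∈ W then 1 else 0
  have hχ : ∀ i j, (kreweras π).part i = (kreweras π).part j → χ i = χ j := by
    intro i j hij
    simp only [χ]
    congr 1
    rw [← (kreweras π).part_eq_iff_mem hW, ← (kreweras π).part_eq_iff_mem hW, hij]
  -- Shifting the rotation from `c` to the indicator `χ` of `W` lets the sum be grouped over the
  -- blocks of `π`, where `c` is constant.
  have h1 : ∑ i ∈ W, cyclicDiff c i = ∑ i, c i * (χ i + χ (finRotate m i)) := by
    have h2 : ∑ i ∈ W, cyclicDiff c i = ∑ i, cyclicDiff c i * χ i := by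
      simp [χ, Finset.sum_ite_mem]
    have h3 : ∑ i, c ((finRotate m).symm i) * χ i = ∑ i, c i * χ (finRotate m i) := by
      rw [← Equiv.sum_comp (finRotate m)]
      simp only [Equiv.symm_apply_apply]
    rw [h2]
    simp only [cyclicDiff, add_mul, mul_add, Finset.sum_add_distrib, h3]
  rw [h1, ← π.biUnion_parts, Finset.sum_biUnion π.disjoint]
  refine Finset.sum_eq_zero fun V hV => ?_
  obtain ⟨x₀, hx₀⟩ := π.nonempty_of_mem_parts hV
  simp only [id]
  rw [Finset.sum_congr rfl fun i hi => by rw [hc V hV i hi x₀ hx₀], ← Finset.mul_sum,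
    Finset.sum_add_distrib]
  have hsum : ∀ f : Fin m → ZMod 2, ∑ i ∈ V, f i = ∑ j, f (V.orderEmbOfFin rfl j) := by
    intro f
    conv_lhs => rw [← Finset.map_orderEmbOfFin_univ V rfl]
    rw [Finset.sum_map]
    rfl
  -- By `rel_next`, `χ` after an element of `V` equals `χ` at the cyclically next element of `V`;
  -- summing over `V` makes the shift disappear.
  have h4 : ∑ i ∈ V, χ (finRotate m i) = ∑ i ∈ V, χ i := by
    rw [hsum, hsum, ← Equiv.sum_comp (finRotate V.card) fun j => χ (V.orderEmbOfFin rfl j)]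
    exact Finset.sum_congr rfl fun j _ => (hχ _ _ (hπ.rel_next hV j)).symm
  rw [h4, zmod_two_add_self, mul_zero]

theorem constOnParts_iff_cyclicDiff {π : SetPartition m} (hπ : NonCrossing π)
    {c : Fin m → ZMod 2} :
    ConstOnParts c π ↔ ∀ W ∈ (kreweras π).parts, ∑ i ∈ W, cyclicDiff c i = 0 := by
  constructor
  · exact fun hc W hW => sum_cyclicDiff_eq_zero hπ hc hW
  · intro h V hV x hx y hy
    have := constOnParts_sum_below h V hV x hx y hy
    simp only [sum_cyclicDiff_mul_below] at this
    exact add_right_cancel this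

/-- The complement determines which colourings are constant on the blocks, and block indicators
among these recover the partition. -/
theorem kreweras_injOn : Set.InjOn kreweras {π : SetPartition m | NonCrossing π} := by
  classical
  intro π hπ σ hσ h
  have hiff : ∀ c : Fin m → ZMod 2, ConstOnParts c π ↔ ConstOnParts c σ := fun c => by
    rw [constOnParts_iff_cyclicDiff hπ, constOnParts_iff_cyclicDiff hσ, h]
  have key : ∀ π σ : SetPartition m, (∀ c : Fin m → ZMod 2, ConstOnParts c σ → ConstOnParts c π) →
      ∀ x y, π.part x = π.part y → σ.part x = σ.part y := by
    intro π σ h x y hxy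
    have h1 : ConstOnParts (fun z => if σ.part z = σ.part x then (1 : ZMod 2) else 0) σ := by
      refine constOnParts_of_part_eq fun z _ t _ hzt => ?_
      rw [hzt]
    have h2 := (h _ h1).eq_of_part_eq (Finset.mem_univ x) (Finset.mem_univ y) hxy
    simp only [if_true] at h2
    by_contra hne
    rw [if_neg (Ne.symm hne)] at h2
    exact one_ne_zero h2
  exact finpartition_ext_part fun x _ y _ =>
    ⟨key π σ (fun c => (hiff c).mpr) x y, key σ π (fun c => (hiff c).mp) x y⟩

/-- An injective self-map of the finite set `NC m` is a bijection, so no inverse has to be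
constructed. -/
theorem sum_NC_kreweras {R : Type*} [AddCommMonoid R] (F : SetPartition m → R) :
    ∑ π ∈ NC m, F (kreweras π) = ∑ σ ∈ NC m, F σ := by
  have hmaps : Set.MapsTo kreweras (NC m : Set (SetPartition m)) (NC m) := fun π _ => by
    rw [NC_eq_ncParts]
    exact mem_ncParts.mpr (nonCrossing_kreweras π)
  have hinj : Set.InjOn kreweras (NC m : Set (SetPartition m)) := by
    refine kreweras_injOn.mono fun π hπ => ?_
    rw [NC_eq_ncParts] at hπ
    exact mem_ncParts.mp hπ
  have hsurj := Finset.surjOn_of_injOn_of_card_le kreweras hmaps hinj le_rfl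
  exact Finset.sum_bij (fun π _ => kreweras π) (fun π hπ => hmaps hπ)
    (fun π hπ σ hσ h => hinj hπ hσ h) (fun σ hσ => by
      obtain ⟨π, hπ, h⟩ := hsurj hσ
      exact ⟨π, hπ, h⟩) fun _ _ => rfl

/-! ### Block counts of a partition and its complement -/

open Classical in
theorem card_parts_eq_card_max (π : SetPartition m) :
    (Finset.univ.filter fun p => ∀ y ∈ π.part p, y ≤ p).card = π.parts.card := by
  refine Finset.card_bij (fun p _ => π.part p) (fun p _ => π.part_mem.mpr (Finset.mem_univ p)) ?_ ?_
  · intro p hp q hq hpq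
    rw [Finset.mem_filter] at hp hq
    exact le_antisymm (hq.2 p (hpq ▸ π.mem_part (Finset.mem_univ p)))
      (hp.2 q (hpq ▸ π.mem_part (Finset.mem_univ q)))
  · intro V hV
    have hne := π.nonempty_of_mem_parts hV
    have h := π.part_eq_of_mem hV (V.max'_mem hne)
    refine ⟨V.max' hne, ?_, h⟩
    rw [Finset.mem_filter, h]
    exact ⟨Finset.mem_univ _, fun y hy => V.le_max' y hy⟩

open Classical in
theorem card_parts_eq_card_min (π : SetPartition m) :
    (Finset.univ.filter fun p => ∀ y ∈ π.part p, p ≤ y).card = π.parts.card := by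
  refine Finset.card_bij (fun p _ => π.part p) (fun p _ => π.part_mem.mpr (Finset.mem_univ p)) ?_ ?_
  · intro p hp q hq hpq
    rw [Finset.mem_filter] at hp hq
    exact le_antisymm (hp.2 q (hpq ▸ π.mem_part (Finset.mem_univ q)))
      (hq.2 p (hpq ▸ π.mem_part (Finset.mem_univ p)))
  · intro V hV
    have hne := π.nonempty_of_mem_parts hV
    have h := π.part_eq_of_mem hV (V.min'_mem hne)
    refine ⟨V.min' hne, ?_, h⟩
    rw [Finset.mem_filter, h]
    exact ⟨Finset.mem_univ _, fun y hy => V.min'_le y hy⟩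

/-- If the interval from some `y < i` up to `p` is a union of blocks, it contains the block of `p`,
which therefore ends at `p`. Conversely, if that block ends at `p`, its minimum serves as `y` by
non-crossing. -/
theorem not_min_kreweras_iff {π : SetPartition m} (hπ : NonCrossing π) {p i : Fin m}
    (hip : i.val = p.val + 1) :
    (¬ ∀ y ∈ (kreweras π).part i, i ≤ y) ↔ ∀ y ∈ π.part p, y ≤ p := by
  have hmem : ∀ y, y ∈ (kreweras π).part i ↔ ConstOnParts (fun x => below y x + below i x) π := by
    intro y
    rw [Finpartition.mem_part_iff_part_eq_part _ (Finset.mem_univ _) (Finset.mem_univ _),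
      kreweras_part_eq_iff]
  have hpP := π.part_mem.mpr (Finset.mem_univ p)
  have hpp := π.mem_part (Finset.mem_univ p)
  constructor
  · intro h
    push Not at h
    obtain ⟨y, hy, hyi⟩ := h
    rw [hmem] at hy
    intro z hz
    have := interval_of_rel hyi.le hy hpP hpp hz
      ⟨by rw [Fin.le_def]; rw [Fin.lt_def] at hyi; omega, by rw [Fin.lt_def]; omega⟩
    have := this.2
    rw [Fin.lt_def] at this
    rw [Fin.le_def]
    omega
  · intro h
    push Not
    set v := (π.part p).min' ⟨p, hpp⟩ with hv
    have hvm : v ∈ π.part p := Finset.min'_mem _ _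
    have hvp : v ≤ p := h v hvm
    have hvi : v < i := by rw [Fin.lt_def]; rw [Fin.le_def] at hvp; omega
    refine ⟨v, (hmem v).mpr (rel_of_interval hvi.le fun U hU x hx y hy hxi => ?_), hvi⟩
    have hlt : ∀ z : Fin m, z < i ↔ z ≤ p := fun z => by rw [Fin.lt_def, Fin.le_def]; omega
    rw [hlt] at hxi ⊢
    by_cases hxp : x ∈ π.part p
    · have hUp := π.eq_of_mem_parts hU hpP hx hxp
      rw [hUp] at hy
      exact ⟨Finset.min'_le _ _ hy, h y hy⟩
    · have hUp : U ≠ π.part p := fun h => hxp (h ▸ hx)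
      have h1 : v < x := lt_of_le_of_ne hxi.1 fun h => hxp (h ▸ hvm)
      have h2 : x < p := lt_of_le_of_ne hxi.2 fun h => hxp (h ▸ hpp)
      constructor
      · by_contra hc
        exact hUp (hπ y v x p (not_le.mp hc) h1 h2 U hU _ hpP hy hx hvm hpp)
      · by_contra hc
        exact hUp (hπ v x p y h1 h2 (not_le.mp hc) _ hpP U hU hvm hpp hx hy).symm

/-- A non-crossing partition and its Kreweras complement have `m + 1` blocks in total. -/
theorem card_add_card_kreweras (hm : 1 ≤ m) {π : SetPartition m} (hπ : NonCrossing π) :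
    π.parts.card + (kreweras π).parts.card = m + 1 := by
  classical
  set A := Finset.univ.filter fun p => ∀ y ∈ π.part p, y ≤ p with hA
  set B := Finset.univ.filter fun p => ∀ y ∈ (kreweras π).part p, p ≤ y with hB
  have hAc : A.card = π.parts.card := card_parts_eq_card_max π
  have hBc : B.card = (kreweras π).parts.card := card_parts_eq_card_min _
  let l : Fin m := ⟨m - 1, by omega⟩
  have hl : l ∈ A := by
    rw [hA, Finset.mem_filter]
    refine ⟨Finset.mem_univ _, fun y _ => ?_⟩
    rw [Fin.le_def]
    have := y.isLt
    simp only [l]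
    omega
  -- The shift `p ↦ p + 1` matches the block maxima of `π` other than the last point with the points
  -- that are not block minima of the complement.
  have h1 : (A.erase l).card = Bᶜ.card := by
    have hlt : ∀ p ∈ A.erase l, p.val + 1 < m := by
      intro p hp
      have h1 := (Finset.mem_erase.mp hp).1
      rw [ne_eq, Fin.ext_iff] at h1
      simp only [l] at h1
      have := p.isLt
      omega
    refine Finset.card_bij (fun p hp => ⟨p.val + 1, hlt p hp⟩) ?_ ?_ ?_
    · intro p hp
      rw [Finset.mem_compl, hB, Finset.mem_filter, not_and]
      intro _
      refine (not_min_kreweras_iff hπ rfl).mpr ?_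
      exact (Finset.mem_filter.mp (Finset.mem_of_mem_erase hp)).2
    · intro p _ q _ hpq
      rw [Fin.ext_iff] at hpq ⊢
      simpa using hpq
    · intro i hi
      rw [Finset.mem_compl, hB, Finset.mem_filter, not_and] at hi
      replace hi := hi (Finset.mem_univ _)
      have hi0 : i.val ≠ 0 := by
        intro h0
        refine hi fun y _ => ?_
        rw [Fin.le_def]
        omega
      have hip : i.val = (⟨i.val - 1, by omega⟩ : Fin m).val + 1 := by simp only; omega
      refine ⟨⟨i.val - 1, by omega⟩, ?_, Fin.ext hip.symm⟩
      rw [Finset.mem_erase, hA, Finset.mem_filter]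
      refine ⟨?_, Finset.mem_univ _, (not_min_kreweras_iff hπ hip).mp hi⟩
      rw [ne_eq, Fin.ext_iff]
      simp only [l]
      omega
  rw [Finset.card_erase_of_mem hl, Finset.card_compl, Fintype.card_fin] at h1
  have h2 : 1 ≤ A.card := Finset.card_pos.mpr ⟨l, hl⟩
  have h3 : B.card ≤ m := by simpa using Finset.card_le_univ B
  omega

end Kreweras

/-! ### The Kreweras complement of the partitions in `𝒳` -/

section PairKreweras

variable {n : ℕ} {π : SetPartition (2 * n)}

theorem finRotate_symm_pairSnd (k : Fin n) :
    (finRotate (2 * n)).symm (pairSnd k) = pairFst k := by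
  rw [Equiv.symm_apply_eq]
  ext
  rw [finRotate_val_of_lt] <;> simp only [pairFst, pairSnd]
  omega

theorem even_or_eq_pairSnd (i : Fin (2 * n)) : Even i.val ∨ i = pairSnd (half i) := by
  rcases eq_pairFst_or_eq_pairSnd i with h | h
  · left
    rw [h]
    exact ⟨(half i).val, by simp only [pairFst]; omega⟩
  · exact Or.inr h

/-- Zero-based even values are the odd numbers. Two of them in one block of the complement bound an
interval that is a union of both blocks and pairs, which disconnects. Conversely, constancy on pairs
kills the differences at even numbers, so each block of the complement retains at most one, and its
zero sum kills that too. -/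
theorem pairConnected_iff_kreweras (hπ : NonCrossing π) : PairConnected π ↔
    ∀ W ∈ (kreweras π).parts, ∀ i ∈ W, ∀ j ∈ W, Even i.val → Even j.val → i = j := by
  constructor
  · intro h
    have key : ∀ W ∈ (kreweras π).parts, ∀ i ∈ W, ∀ j ∈ W, Even i.val → Even j.val →
        ¬ i < j := by
      intro W hW i hi j hj hie hje hij
      have hp : ∀ i : Fin (2 * n), Even i.val → ∀ k : Fin n,
          below i (pairSnd k) = below i (pairFst k) := by
        rintro i ⟨t, ht⟩ k
        simp only [below, Fin.lt_def, pairFst, pairSnd, ht]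
        congr 1
        rw [eq_iff_iff]
        omega
      have := h _ (kreweras_rel hW hi hj) (fun k _ => by simp only [hp i hie, hp j hje]) i
        (Finset.mem_univ _) j (Finset.mem_univ _)
      simp only [below_add_below_of_le hij.le] at this
      rw [if_pos ⟨le_rfl, hij⟩, if_neg fun h => lt_irrefl _ h.2] at this
      exact one_ne_zero this
    intro W hW i hi j hj hie hje
    exact le_antisymm (not_lt.mp (key W hW j hj i hi hje hie))
      (not_lt.mp (key W hW i hi j hj hie hje))
  · intro h c hc hp x _ y _
    have hodd : ∀ i : Fin (2 * n), ¬ Even i.val → cyclicDiff c i = 0 := by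
      intro i hi
      have hi' := (even_or_eq_pairSnd i).resolve_left hi
      rw [hi', cyclicDiff, finRotate_symm_pairSnd, hp _ (Finset.mem_univ _), zmod_two_add_self]
    have hzero : ∀ i, cyclicDiff c i = 0 := by
      intro i
      by_cases hi : Even i.val
      · have hW := (kreweras π).part_mem.mpr (Finset.mem_univ i)
        have hiW := (kreweras π).mem_part (Finset.mem_univ i)
        rw [← sum_cyclicDiff_eq_zero hπ hc hW, Finset.sum_eq_single_of_mem i hiW]
        intro j hj hji
        exact hodd j fun hje => hji (h _ hW j hj i hiW hje hi)
      · exact hodd i hi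
    have hx := sum_cyclicDiff_mul_below c x
    have hy := sum_cyclicDiff_mul_below c y
    simp only [hzero, zero_mul, Finset.sum_const_zero] at hx hy
    exact add_right_cancel (hx.symm.trans hy)

/-- A proper colouring has difference `1` at every even number, so the zero sum over `W` is `|W|`
modulo two. -/
theorem even_card_of_pairBipartite (hπ : NonCrossing π) (h : PairBipartite π)
    {W : Finset (Fin (2 * n))} (hW : W ∈ (kreweras π).parts) (hodd : ∀ i ∈ W, ¬ Even i.val) :
    Even W.card := by
  obtain ⟨c, hc, hp⟩ := h
  have h1 : ∀ i ∈ W, cyclicDiff c i = 1 := by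
    intro i hi
    have hi' := (even_or_eq_pairSnd i).resolve_left (hodd i hi)
    rw [hi', cyclicDiff, finRotate_symm_pairSnd, hp _ (Finset.mem_univ _)]
    linear_combination zmod_two_add_self (c (pairFst (half i)))
  have h2 := sum_cyclicDiff_eq_zero hπ hc hW
  rw [Finset.sum_congr rfl h1, Finset.sum_const, nsmul_eq_mul, mul_one] at h2
  exact (ZMod.natCast_eq_zero_iff_even).mp h2

theorem pairBipartite_of_separatesOdds (h : SeparatesOdds (kreweras π)) : PairBipartite π := by
  classical
  -- Properness prescribes the difference `1` at even numbers. The single odd number of a block is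
  -- free and takes the value `|W| - 1` modulo two that makes the sum vanish.
  let d : Fin (2 * n) → ZMod 2 := fun i =>
    if Even i.val then (((kreweras π).part i).card : ZMod 2) + 1 else 1
  have hd : ∀ W ∈ (kreweras π).parts, ∑ i ∈ W, d i = 0 := by
    intro W hW
    by_cases hex : ∃ i ∈ W, Even i.val
    · obtain ⟨i, hi, hie⟩ := hex
      have h1 : ∀ j ∈ W.erase i, d j = 1 := by
        intro j hj
        rw [Finset.mem_erase] at hj
        exact if_neg fun hje => hj.1 (h.1 W hW j hj.2 i hi hje hie)
      have h2 : d i = (W.card : ZMod 2) + 1 := by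
        simp only [d]
        rw [if_pos hie, (kreweras π).part_eq_of_mem hW hi]
      rw [← Finset.add_sum_erase W d hi, h2, Finset.sum_congr rfl h1, Finset.sum_const,
        nsmul_eq_mul, mul_one]
      have h3 : ((W.erase i).card : ZMod 2) + 1 = W.card := by
        rw [← Nat.cast_one, ← Nat.cast_add, Finset.card_erase_add_one hi]
      linear_combination h3 + zmod_two_add_self (W.card : ZMod 2)
    · push Not at hex
      have h1 : ∀ j ∈ W, d j = 1 := fun j hj => if_neg (hex j hj)
      rw [Finset.sum_congr rfl h1, Finset.sum_const, nsmul_eq_mul, mul_one]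
      exact ZMod.natCast_eq_zero_iff_even.mpr (h.2 W hW hex)
  -- The colouring with differences `d` is the sum of the `d i * below i`; inside the `k`-th pair it
  -- jumps by `d (pairSnd k) = 1`.
  refine ⟨_, constOnParts_sum_below hd, fun k _ => ?_⟩
  have hle : ∀ i : Fin (2 * n), below i (pairSnd k) + below i (pairFst k) =
      if i = pairSnd k then 1 else 0 := by
    intro i
    simp only [below, Fin.lt_def, Fin.ext_iff, pairFst, pairSnd]
    rcases lt_trichotomy i.val (2 * k.val + 1) with h | h | h
    · rw [if_neg (by omega), if_neg (by omega), if_neg (by omega), zero_add]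
    · rw [if_neg (by omega), if_pos (by omega), if_pos h, zero_add]
    · rw [if_pos (by omega), if_pos (by omega), if_neg (by omega), zmod_two_add_self]
  have hdk : d (pairSnd k) = 1 := if_neg (by simp [pairSnd])
  have hsum : ∑ i, d i * below i (pairSnd k) + ∑ i, d i * below i (pairFst k) = 1 := by
    rw [← Finset.sum_add_distrib]
    simp only [← mul_add, hle, mul_ite, mul_one, mul_zero, Finset.sum_ite_eq', Finset.mem_univ,
      if_true, hdk]
  linear_combination hsum - zmod_two_add_self (∑ i, d i * below i (pairFst k))

theorem mem_ncX_iff_kreweras (hn : 1 ≤ n) (hπ : NonCrossing π) :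
    π ∈ ncX n ↔ kreweras π ∈ ncY n := by
  have hY : kreweras π ∈ ncY n ↔ SeparatesOdds (kreweras π) := by
    simp only [ncY, Finset.mem_filter, NC_eq_ncParts, mem_ncParts, nonCrossing_kreweras, true_and]
  rw [mem_ncX hn, hY]
  constructor
  · rintro ⟨-, hc, hb⟩
    exact ⟨(pairConnected_iff_kreweras hπ).mp hc, fun W hW => even_card_of_pairBipartite hπ hb hW⟩
  · intro h
    exact ⟨hπ, (pairConnected_iff_kreweras hπ).mpr h.1, pairBipartite_of_separatesOdds h⟩

/-- The Kreweras complement exchanges the sums over `𝒳` and `𝒴`. -/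
theorem sum_ncX_eq_sum_ncY (r : ℂ) (hn : 1 ≤ n) :
    ∑ π ∈ ncX n, r ^ π.parts.card = ∑ σ ∈ ncY n, r ^ (2 * n + 1 - σ.parts.card) := by
  classical
  have hX : ncX n = (NC (2 * n)).filter fun π => π ∈ ncX n := by
    ext π
    simp only [ncX, Finset.mem_filter]
    tauto
  have hY : ncY n = (NC (2 * n)).filter fun σ => σ ∈ ncY n := by
    ext σ
    simp only [ncY, Finset.mem_filter]
    tauto
  rw [hX, hY, Finset.sum_filter, Finset.sum_filter, 
    ← sum_NC_kreweras fun σ => if σ ∈ ncY n then r ^ (2 * n + 1 - σ.parts.card) else 0]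
  refine Finset.sum_congr rfl fun π hπ => ?_
  rw [NC_eq_ncParts, mem_ncParts] at hπ
  have hcard := card_add_card_kreweras (by omega) hπ
  exact if_congr (mem_ncX_iff_kreweras hn hπ) (by congr 1; omega) rfl

end PairKreweras

end FreeProb

/- Subtraction in the exponent is harmless: a partition of `[2n]` has at most `2n` blocks. -/
theorem corollary1p5 {A : Type*} [Ring A] [Algebra ℂ A] (φ : A →ₗ[ℂ] ℂ) (hφ : φ 1 = 1)
    (a b : A) (hab : FreeProb.Free φ a b) (r : ℂ)
    (ha : FreeProb.IsFreePoisson φ r a) (hb : FreeProb.IsFreePoisson φ r b)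
    (n : ℕ) (hn : 1 ≤ n) :
    FreeProb.cumulant φ n (a * b + b * a) =
        2 * ∑ π ∈ FreeProb.ncX n, r ^ π.parts.card ∧
      FreeProb.cumulant φ n (a * b + b * a) =
        2 * ∑ σ ∈ FreeProb.ncY n, r ^ (2 * n + 1 - σ.parts.card) ∧
      (r = 1 →
        FreeProb.cumulant φ n (a * b + b * a) = 2 * ((FreeProb.ncY n).card : ℂ)) := by
  have hX := FreeProb.cumulant_anticommutator hφ hab ha hb hn
  have hY := hX.trans (congrArg (2 * ·) (FreeProb.sum_ncX_eq_sum_ncY r hn))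
  refine ⟨hX, hY, ?_⟩
  rintro rfl
  simpa using hY
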